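/- Let $F$ be a quadratically closed field of characteristic different from $2$. All algebras are commutative, not necessarily associative or unital, over $F$. **Definitions.** For an algebra $A$, $a\in A$ and $\lambda\in F$ put $A_\lambda(a)=\{u\in A: au=\lambda u\}$. A primitive axis is an idempotent $a\in A$ such that $\dim A_1(a)=1$, $A=A_0(a)\oplus A_1(a)\oplus A_{1/2}(a)$, $A_0(a)A_{1/2}(a)\subseteq A_{1/2}(a)$, $A_1(a)A_{1/2}(a)\subseteq A_{1/2}(a)$, $A_0(a)A_1(a)=0$, $A_0(a)^2\subseteq A_0(a)$, $A_1(a)^2\subseteq A_1(a)$ and $A_{1/2}(a)^2\subseteq A_0(a)\oplus A_1(a)$. The algebra $A$ is a $3$-generated algebra of Jordan type $\frac12$ if it is generated by three primitive axes $a,b,c$. Such an algebra has a unique Frobenius form, that is, a symmetric bilinear form $(\cdot,\cdot)$ with $(xy,z)=(xz,y)$ for all $x,y,z$, normalized by $(a,a)=(b,b)=(c,c)=1$. Its radical is the ideal $R(A)=\{x\in A:(x,y)=0\text{ for all }y\in A\}$. For $\alpha,\beta,\gamma,\psi\in F$ let $A(\alpha,\beta,\gamma,\psi)$ be the universal $3$-generated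 algebra of Jordan type $\frac12$ with generating axes $a,b,c$ and $(a,b)=\alpha$, $(b,c)=\beta$, $(a,c)=\gamma$, $(ab,c)=\psi$. It is $9$-dimensional with basis $a,b,c,ab,bc,ac,a(bc),b(ac),c(ab)$. Write $S(\alpha,\beta,\gamma,\psi)$ for the quotient of $A(\alpha,\beta,\gamma,\psi)$ by its radical. Denote by $S_6$ any of the algebras $S(0,0,\gamma,0)$ with $\gamma\ne 0,1$, and by $S_7$ any of the algebras $S(\alpha,\beta,\gamma,\psi)$ with $\psi^2\neq\alpha\beta\gamma$, $\alpha+\beta+\gamma=2\psi+1$ and $\alpha\ne1$. Let $M_2^+(F)$ be the algebra of $2\times2$ matrices over $F$ with the product $A\circ B=\frac12(AB+BA)$, and let $JForm_2(F)=F\oplus V$ be the algebra with the product $(s,v)\bullet(t,w)=(st+\phi(v,w),\,sw+tv)$, where $V$ is a $2$-dimensional vector space over $F$ with a nondegenerate symmetric bilinear form $\phi$. **Proposition.** Let $A$ be a $4$-dimensional $3$-generated algebra of Jordan type $\frac12$ over $F$ with $R(A)=0$. Then one of the following holds: 1. $A\cong S_6\cong F\oplus JForm_2(F)$; 2. $A\cong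 S_7\cong M_2^+(F)$. Here the isomorphism $S_6\cong F\oplus JForm_2(F)$ holds for all admissible values of $\gamma$, and $S_7\cong M_2^+(F)$ holds for all admissible values of $\alpha,\beta,\gamma,\psi$. The algebra $M_2^+(F)$ is simple and $F\oplus JForm_2(F)$ is not simple; in particular, these two algebras are not isomorphic. -/

import Mathlib

noncomputable section

/-- Two (not necessarily unital or associative) algebras over `F` are isomorphic: there is an
`F`-linear bijection that respects the multiplications. -/
def AlgIso (F : Type*) [Field F] (A B : Type*) [AddCommGroup A] [Module F A] [Mul A]
    [AddCommGroup B] [Module F B] [Mul B] : Prop :=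
  ∃ f : A ≃ₗ[F] B, ∀ x y : A, f (x * y) = f x * f y

/-- A simple algebra: the multiplication is not identically zero, and the only two-sided ideals are
`0` and the whole algebra. -/
def IsSimpleAlg (F : Type*) [Field F] (A : Type*) [AddCommGroup A] [Module F A] [Mul A] : Prop :=
  (∃ x y : A, x * y ≠ 0) ∧
    ∀ I : Submodule F A, (∀ x ∈ I, ∀ y : A, x * y ∈ I ∧ y * x ∈ I) → I = ⊥ ∨ I = ⊤

section JordanType

variable (F : Type*) [Field F] {A : Type*} [NonUnitalNonAssocCommRing A] [Module F A]
  [SMulCommClass F A A] [IsScalarTower F A A]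

/-- The eigenspace `A_μ(a) = {u | a * u = μ • u}` of the multiplication by `a`. -/
def axisEigenspace (a : A) (μ : F) : Submodule F A :=
  Module.End.eigenspace (LinearMap.mulLeft F a) μ

/-- `a` is a primitive axis of Jordan type `1/2`: a primitive idempotent, with
`A = A_0(a) ⊕ A_1(a) ⊕ A_{1/2}(a)` and the fusion rules of Jordan type `1/2`. In characteristic
not two the three eigenvalues are distinct, so that the sum of the eigenspaces is always direct. -/
structure IsAxis (a : A) : Prop where
  idem : a * a = a
  primitive : Module.finrank F (axisEigenspace F a 1) = 1
  decomposition : axisEigenspace F a 0 ⊔ axisEigenspace F a 1 ⊔ axisEigenspace F a (1 / 2) = ⊤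
  zero_zero : ∀ x ∈ axisEigenspace F a 0, ∀ y ∈ axisEigenspace F a 0, x * y ∈ axisEigenspace F a 0
  one_one : ∀ x ∈ axisEigenspace F a 1, ∀ y ∈ axisEigenspace F a 1, x * y ∈ axisEigenspace F a 1
  zero_one : ∀ x ∈ axisEigenspace F a 0, ∀ y ∈ axisEigenspace F a 1, x * y = 0
  zero_half : ∀ x ∈ axisEigenspace F a 0, ∀ y ∈ axisEigenspace F a (1 / 2), x * y ∈ axisEigenspace F a (1 / 2)
  one_half : ∀ x ∈ axisEigenspace F a 1, ∀ y ∈ axisEigenspace F a (1 / 2), x * y ∈ axisEigenspace F a (1 / 2)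
  half_half : ∀ x ∈ axisEigenspace F a (1 / 2), ∀ y ∈ axisEigenspace F a (1 / 2),
    x * y ∈ axisEigenspace F a 0 ⊔ axisEigenspace F a 1

/-- `A` is an algebra of Jordan type `1/2` with the generating set of primitive axes `X`. -/
structure IsJordanTypeHalf (X : Set A) : Prop where
  generates : NonUnitalAlgebra.adjoin F X = ⊤
  axes : ∀ x ∈ X, IsAxis F x

end JordanType

section Frobenius

variable (F : Type*) [Field F] {A : Type*} [NonUnitalNonAssocCommRing A] [Module F A]

/-- A Frobenius form: a symmetric bilinear form that associates with the multiplication, normalized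
by `(x, x) = 1` on the generating axes. -/
structure IsFrobeniusForm (X : Set A) (B : LinearMap.BilinForm F A) : Prop where
  symm : ∀ x y, B x y = B y x
  assoc : ∀ x y z, B (x * y) z = B (x * z) y
  normalized : ∀ x ∈ X, B x x = 1

open Classical in
/-- The Frobenius form of an algebra of Jordan type generated by the axes `X`. There is at most one
normalized Frobenius form on such an algebra. The value is `0` if there is none. -/
def frobeniusForm (X : Set A) : LinearMap.BilinForm F A :=
  if h : ∃ B : LinearMap.BilinForm F A, IsFrobeniusForm F X B then h.choose else 0

theorem frobeniusForm_symm (X : Set A) (x y : A) :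
    frobeniusForm F X x y = frobeniusForm F X y x := by
  unfold frobeniusForm
  split_ifs with h
  · exact h.choose_spec.symm x y
  · rfl

theorem frobeniusForm_assoc (X : Set A) (x y z : A) :
    frobeniusForm F X (x * y) z = frobeniusForm F X (x * z) y := by
  unfold frobeniusForm
  split_ifs with h
  · exact h.choose_spec.assoc x y z
  · rfl

/-- The radical `R(A)` of the Frobenius form. It is an ideal, see `mul_mem_radical`. -/
def radical (X : Set A) : Submodule F A :=
  LinearMap.ker (frobeniusForm F X)

theorem mem_radical {X : Set A} {x : A} :
    x ∈ radical F X ↔ ∀ y, frobeniusForm F X x y = 0 := by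
  simp [radical, LinearMap.mem_ker, LinearMap.ext_iff]

theorem mul_mem_radical {X : Set A} {x : A} (hx : x ∈ radical F X) (y : A) :
    x * y ∈ radical F X := by
  rw [mem_radical] at hx ⊢
  intro z
  rw [mul_comm x y, frobeniusForm_assoc, frobeniusForm_symm, hx]

/-- The quotient algebra `A / R(A)`. -/
def RadicalQuotient (X : Set A) : Type _ := A ⧸ radical F X

namespace RadicalQuotient

variable {F}
variable {X : Set A}

instance : AddCommGroup (RadicalQuotient F X) :=
  inferInstanceAs (AddCommGroup (A ⧸ radical F X))

instance : Module F (RadicalQuotient F X) :=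
  inferInstanceAs (Module F (A ⧸ radical F X))

variable (F X) in
/-- The canonical projection `A → A / R(A)`. -/
def mk : A →ₗ[F] RadicalQuotient F X := (radical F X).mkQ

theorem mk_eq {x y : A} : mk F X x = mk F X y ↔ x - y ∈ radical F X :=
  Submodule.Quotient.eq (radical F X)

theorem mk_surjective : Function.Surjective (mk F X) :=
  Submodule.mkQ_surjective (radical F X)

instance : Mul (RadicalQuotient F X) where
  mul := Quotient.map₂ (· * ·) (by
    intro x₁ x₂ hx y₁ y₂ hy
    replace hx := (Submodule.quotientRel_def _).1 hx
    replace hy := (Submodule.quotientRel_def _).1 hy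
    refine (Submodule.quotientRel_def _).2 ?_
    have h : x₁ * y₁ - x₂ * y₂ = (x₁ - x₂) * y₁ + (y₁ - y₂) * x₂ := by
      rw [sub_mul, sub_mul, mul_comm y₁ x₂, mul_comm y₂ x₂]
      abel
    rw [h]
    exact add_mem (mul_mem_radical F hx _) (mul_mem_radical F hy _))

theorem mk_mul (x y : A) : mk F X (x * y) = mk F X x * mk F X y := rfl

instance : NonUnitalNonAssocCommRing (RadicalQuotient F X) :=
  { (inferInstance : AddCommGroup (RadicalQuotient F X)),
    (inferInstance : Mul (RadicalQuotient F X)) with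
    left_distrib := by
      intro x y z
      obtain ⟨x, rfl⟩ := mk_surjective x
      obtain ⟨y, rfl⟩ := mk_surjective y
      obtain ⟨z, rfl⟩ := mk_surjective z
      rw [← map_add, ← mk_mul, ← mk_mul, ← mk_mul, ← map_add, mul_add]
    right_distrib := by
      intro x y z
      obtain ⟨x, rfl⟩ := mk_surjective x
      obtain ⟨y, rfl⟩ := mk_surjective y
      obtain ⟨z, rfl⟩ := mk_surjective z
      rw [← map_add, ← mk_mul, ← mk_mul, ← mk_mul, ← map_add, add_mul]
    zero_mul := by
      intro x
      obtain ⟨x, rfl⟩ := mk_surjective x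
      rw [← map_zero (mk F X), ← mk_mul, zero_mul]
    mul_zero := by
      intro x
      obtain ⟨x, rfl⟩ := mk_surjective x
      rw [← map_zero (mk F X), ← mk_mul, mul_zero]
    mul_comm := by
      intro x y
      obtain ⟨x, rfl⟩ := mk_surjective x
      obtain ⟨y, rfl⟩ := mk_surjective y
      rw [← mk_mul, ← mk_mul, mul_comm] }

end RadicalQuotient

end Frobenius

/-- The multiplication table of the universal 3-generated algebra `A(α, β, γ, ψ)` in its basis
`a, b, c, ab, bc, ac, a(bc), b(ac), c(ab)` (in this order). Entry `i, j` with `i ≤ j` is the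
coordinate vector of the product of the `i`-th and the `j`-th basis element; the entries below the
diagonal are not used. The parameters are the values `α = (a, b)`, `β = (b, c)`, `γ = (a, c)`,
`ψ = (ab, c)` of the Frobenius form. -/
def universalTable {F : Type*} [Field F] (α β γ ψ : F) : Fin 9 → Fin 9 → (Fin 9 → F)
  | 0, 0 => ![1, 0, 0, 0, 0, 0, 0, 0, 0]
  | 0, 1 => ![0, 0, 0, 1, 0, 0, 0, 0, 0]
  | 0, 2 => ![0, 0, 0, 0, 0, 1, 0, 0, 0]
  | 0, 3 => ![α / 2, 0, 0, 1 / 2, 0, 0, 0, 0, 0]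
  | 0, 4 => ![0, 0, 0, 0, 0, 0, 1, 0, 0]
  | 0, 5 => ![γ / 2, 0, 0, 0, 0, 1 / 2, 0, 0, 0]
  | 0, 6 => ![ψ / 2, 0, 0, 0, 0, 0, 1 / 2, 0, 0]
  | 0, 7 => ![ψ / 4, 0, 0, γ / 4, 0, α / 4, 1 / 4, 1 / 4, -1 / 4]
  | 0, 8 => ![ψ / 4, 0, 0, γ / 4, 0, α / 4, 1 / 4, -1 / 4, 1 / 4]
  | 1, 1 => ![0, 1, 0, 0, 0, 0, 0, 0, 0]
  | 1, 2 => ![0, 0, 0, 0, 1, 0, 0, 0, 0]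
  | 1, 3 => ![0, α / 2, 0, 1 / 2, 0, 0, 0, 0, 0]
  | 1, 4 => ![0, β / 2, 0, 0, 1 / 2, 0, 0, 0, 0]
  | 1, 5 => ![0, 0, 0, 0, 0, 0, 0, 1, 0]
  | 1, 6 => ![0, ψ / 4, 0, β / 4, α / 4, 0, 1 / 4, 1 / 4, -1 / 4]
  | 1, 7 => ![0, ψ / 2, 0, 0, 0, 0, 0, 1 / 2, 0]
  | 1, 8 => ![0, ψ / 4, 0, β / 4, α / 4, 0, -1 / 4, 1 / 4, 1 / 4]
  | 2, 2 => ![0, 0, 1, 0, 0, 0, 0, 0, 0]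
  | 2, 3 => ![0, 0, 0, 0, 0, 0, 0, 0, 1]
  | 2, 4 => ![0, 0, β / 2, 0, 1 / 2, 0, 0, 0, 0]
  | 2, 5 => ![0, 0, γ / 2, 0, 0, 1 / 2, 0, 0, 0]
  | 2, 6 => ![0, 0, ψ / 4, 0, γ / 4, β / 4, 1 / 4, -1 / 4, 1 / 4]
  | 2, 7 => ![0, 0, ψ / 4, 0, γ / 4, β / 4, -1 / 4, 1 / 4, 1 / 4]
  | 2, 8 => ![0, 0, ψ / 2, 0, 0, 0, 0, 0, 1 / 2]
  | 3, 3 => ![α / 4, α / 4, 0, α / 2, 0, 0, 0, 0, 0]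
  | 3, 4 => ![0, ψ / 4, 0, β / 4, α / 4, 0, 1 / 4, -1 / 4, 1 / 4]
  | 3, 5 => ![ψ / 4, 0, 0, γ / 4, 0, α / 4, -1 / 4, 1 / 4, 1 / 4]
  | 3, 6 => ![α * β / 8 + ψ / 8, ψ / 8, 0, ψ / 4, α / 8, 0, α / 4, 0, 0]
  | 3, 7 => ![ψ / 8, α * γ / 8 + ψ / 8, 0, ψ / 4, 0, α / 8, 0, α / 4, 0]
  | 3, 8 => ![α * β / 8, α * γ / 8, 0, ψ / 2, α / 8, α / 8, -α / 4, -α / 4, α / 2]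
  | 4, 4 => ![0, β / 4, β / 4, 0, β / 2, 0, 0, 0, 0]
  | 4, 5 => ![0, 0, ψ / 4, 0, γ / 4, β / 4, 1 / 4, 1 / 4, -1 / 4]
  | 4, 6 => ![0, β * γ / 8, α * β / 8, β / 8, ψ / 2, β / 8, β / 2, -β / 4, -β / 4]
  | 4, 7 => ![0, β * γ / 8 + ψ / 8, ψ / 8, 0, ψ / 4, β / 8, 0, β / 4, 0]
  | 4, 8 => ![0, ψ / 8, α * β / 8 + ψ / 8, β / 8, ψ / 4, 0, 0, 0, β / 4]
  | 5, 5 => ![γ / 4, 0, γ / 4, 0, 0, γ / 2, 0, 0, 0]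
  | 5, 6 => ![β * γ / 8 + ψ / 8, 0, ψ / 8, 0, γ / 8, ψ / 4, γ / 4, 0, 0]
  | 5, 7 => ![β * γ / 8, 0, α * γ / 8, γ / 8, γ / 8, ψ / 2, -γ / 4, γ / 2, -γ / 4]
  | 5, 8 => ![ψ / 8, 0, α * γ / 8 + ψ / 8, γ / 8, 0, ψ / 4, 0, 0, γ / 4]
  | 6, 6 => ![
      α * β / 16 + β * γ / 16 + β * ψ / 8, β * γ / 16, α * β / 16, 0, ψ / 4, 0, β / 8 + ψ / 2,
      -β / 8, -β / 8]
  | 6, 7 => ![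
      β * γ / 16 + β * ψ / 16, β * γ / 16 + γ * ψ / 16, α * ψ / 16, ψ / 8, α * γ / 8 + ψ / 8,
      α * β / 8 + ψ / 8, -α / 16 + β / 16 - γ / 16 + ψ / 4, -α / 16 - β / 16 + γ / 16 + ψ / 4,
      α / 16 - β / 16 - γ / 16 - ψ / 4]
  | 6, 8 => ![
      α * β / 16 + β * ψ / 16, γ * ψ / 16, α * β / 16 + α * ψ / 16, β * γ / 8 + ψ / 8,
      α * γ / 8 + ψ / 8, ψ / 8, -α / 16 + β / 16 - γ / 16 + ψ / 4,
      -α / 16 - β / 16 + γ / 16 - ψ / 4, α / 16 - β / 16 - γ / 16 + ψ / 4]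
  | 7, 7 => ![
      β * γ / 16, α * γ / 16 + β * γ / 16 + γ * ψ / 8, α * γ / 16, 0, 0, ψ / 4, -γ / 8,
      γ / 8 + ψ / 2, -γ / 8]
  | 7, 8 => ![
      β * ψ / 16, α * γ / 16 + γ * ψ / 16, α * γ / 16 + α * ψ / 16, β * γ / 8 + ψ / 8, ψ / 8,
      α * β / 8 + ψ / 8, -α / 16 + β / 16 - γ / 16 - ψ / 4, -α / 16 - β / 16 + γ / 16 + ψ / 4,
      α / 16 - β / 16 - γ / 16 + ψ / 4]
  | 8, 8 => ![
      α * β / 16, α * γ / 16, α * β / 16 + α * γ / 16 + α * ψ / 8, ψ / 4, 0, 0, -α / 8, -α / 8,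
      α / 8 + ψ / 2]
  | _, _ => 0

/-- The universal 9-dimensional 3-generated algebra `A(α, β, γ, ψ)` of Jordan type `1/2`. -/
@[nolint unusedArguments]
def UniversalAlg {F : Type*} [Field F] (_α _β _γ _ψ : F) : Type _ := Fin 9 → F

namespace UniversalAlg

variable {F : Type*} [Field F] {α β γ ψ : F}

instance : AddCommGroup (UniversalAlg α β γ ψ) := inferInstanceAs (AddCommGroup (Fin 9 → F))

instance : Module F (UniversalAlg α β γ ψ) := inferInstanceAs (Module F (Fin 9 → F))

instance : Mul (UniversalAlg α β γ ψ) where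
  mul x y := fun k => ∑ i : Fin 9, ∑ j : Fin 9,
    x i * y j * universalTable α β γ ψ (min i j) (max i j) k

theorem mul_apply (x y : UniversalAlg α β γ ψ) (k : Fin 9) :
    (x * y) k = ∑ i : Fin 9, ∑ j : Fin 9,
      x i * y j * universalTable α β γ ψ (min i j) (max i j) k := rfl

theorem add_apply (x y : UniversalAlg α β γ ψ) (k : Fin 9) : (x + y) k = x k + y k := rfl

theorem zero_apply (k : Fin 9) : (0 : UniversalAlg α β γ ψ) k = 0 := rfl

theorem smul_apply (r : F) (x : UniversalAlg α β γ ψ) (k : Fin 9) : (r • x) k = r * x k := rfl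

instance : NonUnitalNonAssocCommRing (UniversalAlg α β γ ψ) :=
  { (inferInstance : AddCommGroup (UniversalAlg α β γ ψ)),
    (inferInstance : Mul (UniversalAlg α β γ ψ)) with
    left_distrib := by
      intro x y z
      funext k
      simp only [mul_apply, add_apply, mul_add, add_mul, Finset.sum_add_distrib]
    right_distrib := by
      intro x y z
      funext k
      simp only [mul_apply, add_apply, add_mul, Finset.sum_add_distrib]
    zero_mul := by
      intro x
      funext k
      simp only [mul_apply, zero_apply, zero_mul, Finset.sum_const_zero]
    mul_zero := by
      intro x
      funext k
      simp only [mul_apply, zero_apply, zero_mul, mul_zero, Finset.sum_const_zero]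
    mul_comm := by
      intro x y
      funext k
      rw [mul_apply, mul_apply, Finset.sum_comm]
      refine Finset.sum_congr rfl fun i _ => Finset.sum_congr rfl fun j _ => ?_
      rw [min_comm, max_comm, mul_comm (x j)] }

instance : IsScalarTower F (UniversalAlg α β γ ψ) (UniversalAlg α β γ ψ) where
  smul_assoc r x y := by
    funext k
    simp only [smul_eq_mul, mul_apply, smul_apply, Finset.mul_sum, mul_assoc]

instance : SMulCommClass F (UniversalAlg α β γ ψ) (UniversalAlg α β γ ψ) where
  smul_comm r x y := by
    simp only [smul_eq_mul]
    rw [mul_comm x, ← smul_eq_mul, ← smul_assoc, smul_eq_mul, mul_comm x]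

variable (α β γ ψ) in
/-- The set `{a, b, c}` of the generating axes of `A(α, β, γ, ψ)`. -/
def gens : Set (UniversalAlg α β γ ψ) :=
  {(Pi.single 0 1 : Fin 9 → F), (Pi.single 1 1 : Fin 9 → F), (Pi.single 2 1 : Fin 9 → F)}

end UniversalAlg

/-- The quotient `A(α, β, γ, ψ) / R(A(α, β, γ, ψ))` of the universal algebra by its radical. -/
abbrev SemisimpleAlg {F : Type*} [Field F] (α β γ ψ : F) : Type _ :=
  RadicalQuotient F (UniversalAlg.gens α β γ ψ)

/-- The Jordan algebra `F ⊕ V` of the bilinear form `φ` on `V`, with the multiplication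
`(a, v) (b, w) = (a b + φ v w, a w + b v)`. -/
@[nolint unusedArguments]
def JForm {F V : Type*} [Field F] [AddCommGroup V] [Module F V]
    (_φ : LinearMap.BilinForm F V) : Type _ := F × V

namespace JForm

variable {F V : Type*} [Field F] [AddCommGroup V] [Module F V] {φ : LinearMap.BilinForm F V}

instance : AddCommGroup (JForm φ) := inferInstanceAs (AddCommGroup (F × V))

instance : Module F (JForm φ) := inferInstanceAs (Module F (F × V))

instance : Mul (JForm φ) where
  mul x y := (x.1 * y.1 + φ x.2 y.2, x.1 • y.2 + y.1 • x.2)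

end JForm

/-- `2` is invertible in the matrix algebra over a field in which `2` is invertible. This provides
the multiplication `(A B + B A) / 2` on the symmetrized algebra of the matrix algebra. -/
instance invertibleTwoMatrix {F : Type*} [Field F] [Invertible (2 : F)] (n : ℕ) :
    Invertible (2 : Matrix (Fin n) (Fin n) F) where
  invOf := (⅟2 : F) • 1
  invOf_mul_self := by
    have h : (2 : Matrix (Fin n) (Fin n) F) = (2 : F) • 1 := by
      rw [two_smul, one_add_one_eq_two]
    rw [smul_mul_assoc, one_mul, h, smul_smul, invOf_mul_self, one_smul]
  mul_invOf_self := by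
    have h : (2 : Matrix (Fin n) (Fin n) F) = (2 : F) • 1 := by
      rw [two_smul, one_add_one_eq_two]
    rw [mul_smul_comm, mul_one, h, smul_smul, invOf_mul_self, one_smul]

/-- The Jordan algebra `M_n^+(F)`: the `n × n` matrices with the product `(A B + B A) / 2`. -/
abbrev MPlus (n : ℕ) (F : Type*) [Field F] [Invertible (2 : F)] : Type _ :=
  SymAlg (Matrix (Fin n) (Fin n) F)

end

/-! Let `B` be the Frobenius form of `A`; a zero radical means that `B` is nondegenerate. Relative
to an axis a, another axis has a Peirce form b = αa + y + z with α = (a, b), y in A_0(a) and z in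
A_{1/2}(a). If y = 0 or z = 0, then ab lies in the span of a and b. This cannot happen for all three
pairs of generators, since then a, b, c would span `A`, which has dimension 4. So, up to renaming, y
and z are nonzero. Idempotency of b together with b(ba) = ½ ba + ½ (a, b) b determines the products
(`IsNormalizedAxis.axis_components`): yz = ½(1 - α)z, z² = α(1 - α)a + αy, y² = (1 - α)y.

If A_0(a) is larger than Fy, it contains d ≠ 0 orthogonal to y, and a, y, z, d is a basis.
Associativity of `B` gives dz = 0 and dy = εd, so d is an eigenvector of b; its eigenvalue ε is 0 or
1/2, and 1/2 is contradictory. Hence Fd splits off as a copy of F, and a, y, z span the Jordan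
algebra of the form ⟨1, α(1 - α)⟩ (`algIso_prod_of_zero_component`).

If A_0(a) = Fy, then f = y/(1 - α) is an idempotent, a + f is the unit, and `A` is the Jordan
algebra of a nondegenerate form on the 3-dimensional space F(a - f) ⊕ A_{1/2}(a) (`algIso_spinForm`,
`algIso_mPlus_of_zero_component`). Over a quadratically closed field such a form is determined by
its dimension, and Pauli matrices identify the Jordan algebra in dimension 3 with M_2^+(F).

The quotients S_6 and S_7 are identified through `semisimpleAlg_algIso`: a surjective homomorphism
from the universal algebra onto an algebra with a nondegenerate associating form, normalized at the
images of a, b, c, has the radical as its kernel, because the normalized form is unique. What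
remains is to check the multiplication table on nine explicit elements. As these isomorphisms hold
for all admissible parameters, the classification may use any one admissible choice. -/

noncomputable section

open Module

/-! ### Nondegenerate forms over a quadratically closed field -/

section Isometry

variable {F : Type*} [Field F] [Invertible (2 : F)]

/-- Symmetric forms are diagonalizable in characteristic not two. Nondegeneracy makes the diagonal
values nonzero, and square roots of their inverses rescale the basis vectors. -/
theorem exists_orthonormal_basis (hF : ∀ x : F, IsSquare x) {V : Type*} [AddCommGroup V]
    [Module F V] {n : ℕ} (hn : 0 < n) (hV : finrank F V = n) {φ : LinearMap.BilinForm F V}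
    (hs : ∀ x y, φ x y = φ y x) (hφ : ∀ x, (∀ y, φ x y = 0) → x = 0) :
    ∃ e : Basis (Fin n) F V, ∀ i j, φ (e i) (e j) = if i = j then 1 else 0 := by
  subst hV
  have : FiniteDimensional F V := FiniteDimensional.of_finrank_pos hn
  obtain ⟨v, hv⟩ := LinearMap.BilinForm.exists_orthogonal_basis (B := φ) ⟨fun x y => hs x y⟩
  have hv' : ∀ i j, i ≠ j → φ (v i) (v j) = 0 := fun i j hij => hv hij
  have hne : ∀ i, φ (v i) (v i) ≠ 0 := by
    intro i h0
    refine v.ne_zero i (hφ _ fun y => ?_)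
    have : φ (v i) = 0 := v.ext fun j => by
      by_cases hij : i = j
      · subst hij; simpa using h0
      · simpa using hv' i j hij
    rw [this, LinearMap.zero_apply]
  choose w hw using fun i => hF (φ (v i) (v i))⁻¹
  have hw0 : ∀ i, w i ≠ 0 := by
    intro i h
    have := hw i
    rw [h, mul_zero, inv_eq_zero] at this
    exact hne i this
  refine ⟨v.isUnitSMul (w := w) fun i => (hw0 i).isUnit, fun i j => ?_⟩
  rw [Basis.isUnitSMul_apply, Basis.isUnitSMul_apply]
  simp only [map_smul, LinearMap.smul_apply, smul_eq_mul]
  split_ifs with hij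
  · subst hij
    rw [← mul_assoc, ← hw, inv_mul_cancel₀ (hne i)]
  · rw [hv' i j hij, mul_zero, mul_zero]

theorem exists_isometry (hF : ∀ x : F, IsSquare x) {V W : Type*} [AddCommGroup V]
    [Module F V] [AddCommGroup W] [Module F W] {n : ℕ} (hn : 0 < n) (hV : finrank F V = n)
    (hW : finrank F W = n) {φ : LinearMap.BilinForm F V} {χ : LinearMap.BilinForm F W}
    (hs : ∀ x y, φ x y = φ y x) (hφ : ∀ x, (∀ y, φ x y = 0) → x = 0)
    (hs' : ∀ x y, χ x y = χ y x) (hχ : ∀ x, (∀ y, χ x y = 0) → x = 0) :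
    ∃ L : V ≃ₗ[F] W, ∀ x y, χ (L x) (L y) = φ x y := by
  obtain ⟨e, he⟩ := exists_orthonormal_basis hF hn hV hs hφ
  obtain ⟨e', he'⟩ := exists_orthonormal_basis hF hn hW hs' hχ
  refine ⟨e.equiv e' (Equiv.refl _), ?_⟩
  have : χ.compl₁₂ (e.equiv e' (Equiv.refl _)).toLinearMap
      (e.equiv e' (Equiv.refl _)).toLinearMap = φ := by
    refine e.ext fun i => e.ext fun j => ?_
    simp [he, he']
  intro x y
  rw [← this]
  rfl

end Isometry

/-! ### Isomorphisms, simplicity, and Jordan algebras of bilinear forms -/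

section AlgIso

variable {F : Type*} [Field F]

theorem AlgIso.symm {A B : Type*} [AddCommGroup A] [Module F A] [Mul A]
    [AddCommGroup B] [Module F B] [Mul B] (h : AlgIso F A B) : AlgIso F B A := by
  obtain ⟨f, hf⟩ := h
  refine ⟨f.symm, fun x y => f.injective ?_⟩
  rw [hf, f.apply_symm_apply, f.apply_symm_apply, f.apply_symm_apply]

theorem AlgIso.trans {A B C : Type*} [AddCommGroup A] [Module F A] [Mul A]
    [AddCommGroup B] [Module F B] [Mul B] [AddCommGroup C] [Module F C] [Mul C]
    (h : AlgIso F A B) (h' : AlgIso F B C) : AlgIso F A C := by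
  obtain ⟨f, hf⟩ := h
  obtain ⟨g, hg⟩ := h'
  exact ⟨f.trans g, fun x y => by simp [hf, hg]⟩

theorem AlgIso.prod {A B C D : Type*} [AddCommGroup A] [Module F A] [Mul A]
    [AddCommGroup B] [Module F B] [Mul B] [AddCommGroup C] [Module F C] [Mul C]
    [AddCommGroup D] [Module F D] [Mul D]
    (h : AlgIso F A B) (h' : AlgIso F C D) : AlgIso F (A × C) (B × D) := by
  obtain ⟨f, hf⟩ := h
  obtain ⟨g, hg⟩ := h'
  refine ⟨f.prodCongr g, fun x y => ?_⟩
  ext <;> simp [hf, hg]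

theorem AlgIso.refl (A : Type*) [AddCommGroup A] [Module F A] [Mul A] : AlgIso F A A :=
  ⟨LinearEquiv.refl F A, fun _ _ => rfl⟩

theorem IsSimpleAlg.of_algIso {A B : Type*} [AddCommGroup A] [Module F A] [Mul A]
    [AddCommGroup B] [Module F B] [Mul B] (h : AlgIso F A B) (hB : IsSimpleAlg F B) :
    IsSimpleAlg F A := by
  obtain ⟨f, hf⟩ := h
  obtain ⟨⟨x, y, hxy⟩, hI⟩ := hB
  refine ⟨⟨f.symm x, f.symm y, fun h0 => hxy ?_⟩, fun I hII => ?_⟩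
  · have := congrArg f h0
    simpa [hf] using this
  · have key := hI (I.map (f : A →ₗ[F] B)) (by
      rintro _ ⟨z, hz, rfl⟩ w
      refine ⟨⟨z * f.symm w, (hII z hz _).1, ?_⟩, ⟨f.symm w * z, (hII z hz _).2, ?_⟩⟩ <;>
        simp [hf])
    rcases key with h | h
    · left
      exact Submodule.map_eq_bot_iff.1 h
    · right
      rw [eq_top_iff]
      intro z _
      have : f z ∈ I.map (f : A →ₗ[F] B) := h ▸ Submodule.mem_top
      obtain ⟨w, hw, hwz⟩ := this
      exact f.injective hwz ▸ hw

namespace JForm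

variable {V : Type*} [AddCommGroup V] [Module F V] {φ : LinearMap.BilinForm F V}

theorem mul_fst (x y : JForm φ) : (x * y).1 = x.1 * y.1 + φ x.2 y.2 := rfl
theorem mul_snd (x y : JForm φ) : (x * y).2 = x.1 • y.2 + y.1 • x.2 := rfl
theorem add_fst (x y : JForm φ) : (x + y).1 = x.1 + y.1 := rfl
theorem add_snd (x y : JForm φ) : (x + y).2 = x.2 + y.2 := rfl
theorem smul_fst (r : F) (x : JForm φ) : (r • x).1 = r * x.1 := rfl
theorem smul_snd (r : F) (x : JForm φ) : (r • x).2 = r • x.2 := rfl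
theorem zero_fst : (0 : JForm φ).1 = 0 := rfl
theorem zero_snd : (0 : JForm φ).2 = 0 := rfl
theorem ext {x y : JForm φ} (h : x.1 = y.1) (h' : x.2 = y.2) : x = y := Prod.ext h h'

variable (φ) in
/-- The element `s + v` of `JForm φ`. -/
def mk (s : F) (v : V) : JForm φ := (s, v)

theorem mk_fst (s : F) (v : V) : (mk φ s v).1 = s := rfl
theorem mk_snd (s : F) (v : V) : (mk φ s v).2 = v := rfl
theorem mk_mul_mk (s t : F) (v w : V) :
    mk φ s v * mk φ t w = mk φ (s * t + φ v w) (s • w + t • v) := rfl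

/-- The linear map `JForm φ → A` which sends the unit to `u` and is `h` on `V`. -/
def lift {A : Type*} [AddCommGroup A] [Module F A] (u : A) (h : V →ₗ[F] A) : JForm φ →ₗ[F] A where
  toFun x := x.1 • u + h x.2
  map_add' x y := by rw [add_fst, add_snd, map_add, add_smul]; abel
  map_smul' r x := by rw [smul_fst, smul_snd, map_smul, mul_smul, RingHom.id_apply, smul_add]

theorem lift_apply {A : Type*} [AddCommGroup A] [Module F A] (u : A) (h : V →ₗ[F] A)
    (x : JForm φ) : lift u h x = x.1 • u + h x.2 := rfl

theorem lift_mul {A : Type*} [NonUnitalNonAssocRing A] [Module F A] [SMulCommClass F A A]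
    [IsScalarTower F A A] {u : A} {h : V →ₗ[F] A} (huu : u * u = u) (hu : ∀ v, u * h v = h v)
    (hu' : ∀ v, h v * u = h v) (hh : ∀ v w, h v * h w = φ v w • u) (x y : JForm φ) :
    lift u h (x * y) = lift u h x * lift u h y := by
  simp only [lift_apply, mul_fst, mul_snd, add_mul, mul_add, smul_mul_assoc, mul_smul_comm, huu,
    hu, hu', hh, map_add, map_smul]
  module

theorem algIso_of_isometry {W : Type*} [AddCommGroup W] [Module F W]
    {χ : LinearMap.BilinForm F W} (L : V ≃ₗ[F] W) (hL : ∀ x y, χ (L x) (L y) = φ x y) :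
    AlgIso F (JForm φ) (JForm χ) := by
  refine ⟨{ toFun := fun x => (x.1, L x.2)
            invFun := fun x => (x.1, L.symm x.2)
            map_add' := fun x y => ext rfl (map_add L _ _)
            map_smul' := fun r x => ext rfl (map_smul L _ _)
            left_inv := fun x => ext rfl (L.symm_apply_apply _)
            right_inv := fun x => ext rfl (L.apply_symm_apply _) }, fun x y => ext ?_ ?_⟩
  · exact congrArg (x.1 * y.1 + ·) (hL _ _).symm
  · change L (x.1 • y.2 + y.1 • x.2) = x.1 • L y.2 + y.1 • L x.2
    simp

/-- This makes the choice of the form immaterial: each structural computation may use whichever form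
arises naturally, and only its dimension and nondegeneracy matter. -/
theorem algIso [Invertible (2 : F)] (hF : ∀ x : F, IsSquare x) {W : Type*} [AddCommGroup W]
    [Module F W] {n : ℕ} (hn : 0 < n) (hV : finrank F V = n)
    (hW : finrank F W = n) {χ : LinearMap.BilinForm F W}
    (hs : ∀ x y, φ x y = φ y x) (hφ : ∀ x, (∀ y, φ x y = 0) → x = 0)
    (hs' : ∀ x y, χ x y = χ y x) (hχ : ∀ x, (∀ y, χ x y = 0) → x = 0) :
    AlgIso F (JForm φ) (JForm χ) := by
  obtain ⟨L, hL⟩ := exists_isometry hF hn hV hW hs hφ hs' hχ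
  exact algIso_of_isometry L hL

/-- The summand F × 0, the kernel of the second projection, is a proper nonzero ideal. -/
theorem not_isSimpleAlg_prod : ¬ IsSimpleAlg F (F × JForm φ) := by
  rintro ⟨-, h⟩
  rcases h (LinearMap.ker (LinearMap.snd F F (JForm φ))) (by
    rintro ⟨s, x⟩ hx ⟨t, y⟩
    have hx : x = 0 := hx
    subst hx
    refine ⟨?_, ?_⟩
    · change (0 : JForm φ) * y = 0
      refine ext ?_ ?_
      · rw [mul_fst, zero_fst, zero_snd]; simp
      · rw [mul_snd, zero_fst, zero_snd]; simp
    · change y * (0 : JForm φ) = 0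
      refine ext ?_ ?_
      · rw [mul_fst, zero_fst, zero_snd]; simp
      · rw [mul_snd, zero_fst, zero_snd]; simp) with h | h
  · have : ((1, 0) : F × JForm φ) ∈ LinearMap.ker (LinearMap.snd F F (JForm φ)) := rfl
    rw [h, Submodule.mem_bot] at this
    exact one_ne_zero (congrArg Prod.fst this)
  · have : ((0, (1, 0)) : F × JForm φ) ∈ LinearMap.ker (LinearMap.snd F F (JForm φ)) :=
      h ▸ Submodule.mem_top
    have : ((1, 0) : JForm φ) = 0 := this
    exact one_ne_zero (congrArg Prod.fst this)

end JForm

end AlgIso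

/-! ### M_2^+(F) as the Jordan algebra of the dot product on F³, and its simplicity -/

section MPlus

variable {F : Type*} [Field F] [Invertible (2 : F)]

/-- The dot product on `F³`. -/
def dotForm (F : Type*) [Field F] : LinearMap.BilinForm F (Fin 3 → F) :=
  Matrix.toBilin' 1

omit [Invertible (2 : F)] in
theorem dotForm_apply (v w : Fin 3 → F) :
    dotForm F v w = v 0 * w 0 + v 1 * w 1 + v 2 * w 2 := by
  simp [dotForm, Matrix.toBilin'_apply', dotProduct, Fin.sum_univ_three]

omit [Invertible (2 : F)] in
theorem dotForm_nondegenerate (v : Fin 3 → F) (h : ∀ w, dotForm F v w = 0) : v = 0 := by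
  funext i
  have h0 := h (Pi.single 0 1)
  have h1 := h (Pi.single 1 1)
  have h2 := h (Pi.single 2 1)
  simp only [dotForm_apply] at h0 h1 h2
  fin_cases i
  · simpa using h0
  · simpa using h1
  · simpa using h2

instance : SMulCommClass F (MPlus 2 F) (MPlus 2 F) where
  smul_comm r x y := by
    apply SymAlg.unsym_injective
    simp only [smul_eq_mul, SymAlg.unsym_smul, SymAlg.unsym_mul, mul_smul_comm, smul_mul_assoc,
      ← smul_add]

instance : IsScalarTower F (MPlus 2 F) (MPlus 2 F) where
  smul_assoc r x y := by
    apply SymAlg.unsym_injective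
    simp only [smul_eq_mul, SymAlg.unsym_smul, SymAlg.unsym_mul, mul_smul_comm, smul_mul_assoc,
      ← smul_add]

theorem two_ne_zero_of_invertible : (2 : F) ≠ 0 := Invertible.ne_zero 2

/-- The linear map that sends the standard basis of `F³` to the Pauli matrices; `i` is a square root
of `-1`. -/
def pauli (i : F) : (Fin 3 → F) →ₗ[F] MPlus 2 F where
  toFun v := SymAlg.sym !![v 0, v 1 + i * v 2; v 1 - i * v 2, - v 0]
  map_add' v w := by
    rw [← SymAlg.sym_add]
    congr 1
    ext a b
    fin_cases a <;> fin_cases b <;> simp <;> ring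
  map_smul' r v := by
    rw [RingHom.id_apply, ← SymAlg.sym_smul]
    congr 1
    ext a b
    fin_cases a <;> fin_cases b <;> simp <;> ring

theorem pauli_mul {i : F} (hi : i * i = -1) (v w : Fin 3 → F) :
    pauli i v * pauli i w = dotForm F v w • 1 := by
  apply SymAlg.unsym_injective
  have h2 : (2 : F) ≠ 0 := two_ne_zero_of_invertible
  have h : (⅟2 : Matrix (Fin 2) (Fin 2) F) = (2⁻¹ : F) • 1 := by
    change (⅟2 : F) • (1 : Matrix (Fin 2) (Fin 2) F) = _
    rw [invOf_eq_inv]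
  rw [SymAlg.unsym_mul, h, dotForm_apply, SymAlg.unsym_smul, SymAlg.unsym_one]
  have h' : ∀ M N : Matrix (Fin 2) (Fin 2) F, (2 : F) • M = (2 : F) • N → M = N :=
    fun M N h => smul_right_injective _ h2 h
  apply h'
  rw [smul_mul_assoc, one_mul, smul_smul, mul_inv_cancel₀ h2, one_smul]
  ext a b
  fin_cases a <;> fin_cases b <;>
    simp [pauli]
  · linear_combination (- 2 * v 2 * w 2) * hi
  · ring
  · ring
  · linear_combination (- 2 * v 2 * w 2) * hi

theorem unsym_lift_pauli (i : F) (x : JForm (dotForm F)) :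
    SymAlg.unsym (JForm.lift 1 (pauli i) x) =
      !![x.1 + x.2 0, x.2 1 + i * x.2 2; x.2 1 - i * x.2 2, x.1 - x.2 0] := by
  rw [JForm.lift_apply, SymAlg.unsym_add, SymAlg.unsym_smul, SymAlg.unsym_one]
  ext a b
  fin_cases a <;> fin_cases b <;> simp [pauli, sub_eq_add_neg]

/-- A 2 × 2 matrix is a scalar plus a traceless matrix, and the symmetrized product of two traceless
matrices is a scalar. The Pauli matrices are an orthonormal basis of the traceless part; a square
root of -1 is needed to write them over F. -/
theorem algIso_jForm_mPlus (hF : ∀ x : F, IsSquare x) : AlgIso F (JForm (dotForm F)) (MPlus 2 F) := by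
  obtain ⟨i, hi⟩ := hF (-1)
  have h2 : (2 : F) ≠ 0 := two_ne_zero_of_invertible
  have hi0 : i ≠ 0 := by
    rintro rfl
    simp at hi
  refine ⟨LinearEquiv.ofBijective (JForm.lift 1 (pauli i)) ⟨?_, ?_⟩,
    JForm.lift_mul (by simp) (by simp) (by simp) (pauli_mul hi.symm)⟩
  · rw [← LinearMap.ker_eq_bot, LinearMap.ker_eq_bot']
    intro x h
    replace h := congrArg SymAlg.unsym h
    rw [unsym_lift_pauli] at h
    have h00 : x.1 + x.2 0 = 0 := congrFun (congrFun h 0) 0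
    have h01 : x.2 1 + i * x.2 2 = 0 := congrFun (congrFun h 0) 1
    have h10 : x.2 1 - i * x.2 2 = 0 := congrFun (congrFun h 1) 0
    have h11 : x.1 - x.2 0 = 0 := congrFun (congrFun h 1) 1
    have hs : x.1 = 0 := mul_left_cancel₀ h2 (by linear_combination h00 + h11)
    have hv1 : x.2 1 = 0 := mul_left_cancel₀ h2 (by linear_combination h01 + h10)
    have hv2 : x.2 2 = 0 :=
      mul_left_cancel₀ (mul_ne_zero h2 hi0) (by linear_combination h01 - h10)
    refine JForm.ext hs (funext fun k => ?_)
    fin_cases k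
    · change x.2 0 = 0
      linear_combination h00 - hs
    · exact hv1
    · exact hv2
  · intro x
    obtain ⟨M, rfl⟩ := SymAlg.sym_surjective x
    refine ⟨JForm.mk _ ((M 0 0 + M 1 1) / 2) ![(M 0 0 - M 1 1) / 2, (M 0 1 + M 1 0) / 2,
      (M 0 1 - M 1 0) / (2 * i)], SymAlg.unsym_injective ?_⟩
    rw [unsym_lift_pauli, JForm.mk_fst, JForm.mk_snd,
      SymAlg.unsym_sym]
    ext a b
    fin_cases a <;> fin_cases b <;> simp <;> field_simp <;> ring

omit [Invertible (2 : F)] in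
theorem isSimpleAlg_jForm_dotForm : IsSimpleAlg F (JForm (dotForm F)) := by
  refine ⟨⟨JForm.mk _ 1 0, JForm.mk _ 1 0, fun h => ?_⟩, fun I hI => ?_⟩
  · have := congrArg Prod.fst h
    simp [JForm.mul_fst, JForm.zero_fst, JForm.mk_fst, JForm.mk_snd] at this
  by_cases hbot : I = ⊥
  · exact Or.inl hbot
  right
  obtain ⟨x, hx, hx0⟩ := Submodule.exists_mem_ne_zero_of_ne_bot hbot
  -- Multiplying twice by e₀ and then twice by e₁ kills the vector part: (s, v) ↦ (v₀, s e₀) ↦ (s,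
  -- v₀ e₀) ↦ (0, s e₁) ↦ (s, 0).
  have hfst : ∀ x ∈ I, JForm.mk (dotForm F) x.1 0 ∈ I := by
    intro x hx
    have h0 := (hI _ (hI x hx (JForm.mk _ 0 ![1, 0, 0])).2 (JForm.mk _ 0 ![1, 0, 0])).2
    have h1 := (hI _ (hI _ h0 (JForm.mk _ 0 ![0, 1, 0])).2 (JForm.mk _ 0 ![0, 1, 0])).2
    convert h1 using 1
    have hx : x = JForm.mk _ x.1 x.2 := rfl
    rw [hx]
    simp only [JForm.mk_mul_mk, dotForm_apply]
    refine JForm.ext ?_ (funext fun k => ?_)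
    · simp [JForm.mk_fst]
    · fin_cases k <;> simp [JForm.mk_snd]
  have hall : ∀ s : F, s ≠ 0 → JForm.mk (dotForm F) s 0 ∈ I → I = ⊤ := by
    intro s hs h
    rw [eq_top_iff]
    intro y _
    convert (hI _ h (s⁻¹ • y)).1 using 1
    refine JForm.ext ?_ ?_
    · rw [JForm.mul_fst, JForm.smul_fst, JForm.mk_fst, JForm.mk_snd, map_zero, LinearMap.zero_apply, add_zero,
        mul_inv_cancel_left₀ hs]
    · rw [JForm.mul_snd, JForm.smul_snd, JForm.mk_fst, JForm.mk_snd, smul_zero, add_zero, smul_smul, mul_inv_cancel₀ hs,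
        one_smul]
  -- If the scalar part of x vanishes, multiplication by a vector not orthogonal to x produces a
  -- nonzero scalar part inside the ideal.
  by_cases h1 : x.1 = 0
  · have h2 : x.2 ≠ 0 := fun h => hx0 (JForm.ext h1 h)
    obtain ⟨w, hw⟩ : ∃ w, dotForm F x.2 w ≠ 0 := by
      by_contra! h
      exact h2 (dotForm_nondegenerate _ h)
    refine hall _ hw ?_
    have := hfst _ (hI x hx (JForm.mk _ 0 w)).1
    rwa [JForm.mul_fst, JForm.mk_fst, JForm.mk_snd, h1, zero_mul, zero_add] at this
  · exact hall _ h1 (hfst x hx)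

end MPlus

/-! ### Peirce decomposition relative to an axis -/

section Peirce

variable {F : Type*} [Field F] {A : Type*} [NonUnitalNonAssocCommRing A] [Module F A]
  [SMulCommClass F A A] [IsScalarTower F A A]

set_option linter.unusedSectionVars false

theorem mem_axisEigenspace {a x : A} {μ : F} : x ∈ axisEigenspace F a μ ↔ a * x = μ • x :=
  Module.End.mem_eigenspace_iff

variable (F) in
/-- A symmetric bilinear form that associates with the multiplication. -/
structure IsAssocForm (B : LinearMap.BilinForm F A) : Prop where
  symm : ∀ x y, B x y = B y x
  assoc : ∀ x y z, B (x * y) z = B (x * z) y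

namespace IsAssocForm

variable {B : LinearMap.BilinForm F A} (hB : IsAssocForm F B)
include hB

theorem mul_right (x y z : A) : B x (y * z) = B (x * y) z := by
  rw [hB.symm, hB.assoc, mul_comm]

theorem orthogonal {a x y : A} {μ ν : F} (hμν : μ ≠ ν) (hx : x ∈ axisEigenspace F a μ)
    (hy : y ∈ axisEigenspace F a ν) : B x y = 0 := by
  rw [mem_axisEigenspace] at hx hy
  have h := hB.assoc a x y
  rw [hx, hy, map_smul, map_smul, LinearMap.smul_apply, LinearMap.smul_apply, hB.symm y x,
    smul_eq_mul, smul_eq_mul, ← sub_eq_zero, ← sub_mul] at h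
  exact (mul_eq_zero.1 h).resolve_left (sub_ne_zero.2 hμν)

end IsAssocForm

/-- An axis `a` in an algebra with an associating form `B`, normalized at `a`. -/
structure IsNormalizedAxis (B : LinearMap.BilinForm F A) (a : A) : Prop extends
    IsAxis F a, IsAssocForm F B where
  normalized : B a a = 1

namespace IsNormalizedAxis

variable {B : LinearMap.BilinForm F A} {a : A} (ha : IsNormalizedAxis B a)
include ha

theorem ne_zero : a ≠ 0 := by
  rintro rfl
  simpa using ha.normalized

theorem mem_one : a ∈ axisEigenspace F a (1 : F) := by
  rw [mem_axisEigenspace, ha.idem, one_smul]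

theorem eq_smul {x : A} (hx : x ∈ axisEigenspace F a (1 : F)) : x = B a x • a := by
  have h := (finrank_eq_one_iff_of_nonzero' (⟨a, ha.mem_one⟩ : axisEigenspace F a (1 : F))
    (fun h => ha.ne_zero (congrArg Subtype.val h))).1 ha.primitive ⟨x, hx⟩
  obtain ⟨t, ht⟩ := h
  have ht : t • a = x := congrArg Subtype.val ht
  rw [← ht, map_smul, ha.normalized, smul_eq_mul, mul_one]

theorem form_zero {x : A} (hx : x ∈ axisEigenspace F a (0 : F)) : B a x = 0 :=
  ha.orthogonal one_ne_zero ha.mem_one hx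

theorem form_half (h2 : (2 : F) ≠ 0) {x : A} (hx : x ∈ axisEigenspace F a (1 / 2 : F)) :
    B a x = 0 :=
  ha.orthogonal (fun h => one_ne_zero (α := F) (by
    rw [eq_div_iff h2] at h
    linear_combination h)) ha.mem_one hx

theorem form_zero_half (h2 : (2 : F) ≠ 0) {x y : A} (hx : x ∈ axisEigenspace F a (0 : F))
    (hy : y ∈ axisEigenspace F a (1 / 2 : F)) : B x y = 0 :=
  ha.orthogonal (one_div_ne_zero h2).symm hx hy

/-- The Peirce decomposition of an element relative to an axis. -/
theorem exists_peirce (h2 : (2 : F) ≠ 0) (x : A) : ∃ y ∈ axisEigenspace F a (0 : F),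
    ∃ z ∈ axisEigenspace F a (1 / 2 : F), x = B a x • a + y + z := by
  have hx : x ∈ axisEigenspace F a (0 : F) ⊔ axisEigenspace F a 1 ⊔ axisEigenspace F a (1 / 2) :=
    ha.decomposition ▸ Submodule.mem_top
  obtain ⟨w, hw, z, hz, rfl⟩ := Submodule.mem_sup.1 hx
  obtain ⟨y, hy, u, hu, rfl⟩ := Submodule.mem_sup.1 hw
  refine ⟨y, hy, z, hz, ?_⟩
  rw [map_add, map_add, ha.form_zero hy, ha.form_half h2 hz, zero_add, add_zero, ← ha.eq_smul hu,
    add_comm u y]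

/-- For x = ta + y + z one has ax = ta + z/2 and a(ax) = ta + z/4, with t = (a, x). The identity
encodes the three eigenvalues and primitivity at once, and applies to any x without naming its
components. -/
theorem mul_mul (h2 : (2 : F) ≠ 0) (x : A) :
    a * (a * x) = (1 / 2 : F) • (a * x) + (B a x / 2) • a := by
  obtain ⟨y, hy, z, hz, hx⟩ := ha.exists_peirce h2 x
  rw [mem_axisEigenspace] at hy hz
  generalize B a x = t at hx ⊢
  subst hx
  simp only [mul_add, mul_smul_comm, ha.idem, hy, hz, zero_smul, mul_zero]
  match_scalars <;> field_simp <;> ring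

/-- The product of two elements of the `1/2`-eigenspace. -/
theorem half_mul_half {x y : A} (hx : x ∈ axisEigenspace F a (1 / 2 : F))
    (hy : y ∈ axisEigenspace F a (1 / 2 : F)) :
    ∃ z ∈ axisEigenspace F a (0 : F), x * y = (B x y / 2) • a + z := by
  obtain ⟨z, hz, w, hw, h⟩ := Submodule.mem_sup.1 (ha.half_half x hx y hy)
  refine ⟨z, hz, ?_⟩
  -- The coefficient at a is (a, xy) = (ax, y) = (x, y)/2.
  have hBw : B a (x * y) = B x y / 2 := by
    rw [ha.mul_right, mem_axisEigenspace.1 hx, map_smul, LinearMap.smul_apply, smul_eq_mul]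
    ring
  rw [← hBw, ← h, map_add, ha.form_zero hz, zero_add, ← ha.eq_smul hw, add_comm]

theorem eq_zero_of_components (h2 : (2 : F) ≠ 0) {t : F} {y z : A}
    (hy : y ∈ axisEigenspace F a (0 : F)) (hz : z ∈ axisEigenspace F a (1 / 2 : F))
    (h : t • a + y + z = 0) : t = 0 ∧ y = 0 ∧ z = 0 := by
  have ht : t = 0 := by
    have := congrArg (B a) h
    rwa [map_add, map_add, map_smul, ha.normalized, ha.form_zero hy, ha.form_half h2 hz, map_zero,
      add_zero, add_zero, smul_eq_mul, mul_one] at this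
  subst ht
  rw [zero_smul, zero_add] at h
  have h' := congrArg (a * ·) h
  simp only [mul_add, mem_axisEigenspace.1 hy, mem_axisEigenspace.1 hz, mul_zero, zero_smul,
    zero_add] at h'
  have hz0 : z = 0 := (smul_eq_zero.1 h').resolve_left (one_div_ne_zero h2)
  subst hz0
  exact ⟨rfl, by simpa using h, rfl⟩

theorem components_eq (h2 : (2 : F) ≠ 0) {t t' : F} {y z y' z' : A}
    (hy : y ∈ axisEigenspace F a (0 : F)) (hz : z ∈ axisEigenspace F a (1 / 2 : F))
    (hy' : y' ∈ axisEigenspace F a (0 : F)) (hz' : z' ∈ axisEigenspace F a (1 / 2 : F))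
    (h : t • a + y + z = t' • a + y' + z') : t = t' ∧ y = y' ∧ z = z' := by
  obtain ⟨h1, h3, h4⟩ := ha.eq_zero_of_components h2 (t := t - t') (sub_mem hy hy')
    (sub_mem hz hz') (by rw [← sub_eq_zero] at h; rw [← h]; module)
  exact ⟨sub_eq_zero.1 h1, sub_eq_zero.1 h3, sub_eq_zero.1 h4⟩

/-- The Peirce components `y`, `z` of an axis `α • a + y + z` relative to the axis `a`. -/
theorem axis_components (h2 : (2 : F) ≠ 0) {α : F} {y z : A}
    (hy : y ∈ axisEigenspace F a (0 : F)) (hz : z ∈ axisEigenspace F a (1 / 2 : F))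
    (hb : IsNormalizedAxis B (α • a + y + z)) :
    y * z = ((1 - α) / 2) • z ∧ z * z = (α - α ^ 2) • a + α • y ∧ y * y = (1 - α) • y ∧
      B z z = 2 * (α - α ^ 2) ∧ B y y = (1 - α) ^ 2 := by
  have hay := mem_axisEigenspace.1 hy
  have haz := mem_axisEigenspace.1 hz
  have hya : y * a = 0 := by rw [mul_comm, hay, zero_smul]
  have hza : z * a = (1 / 2 : F) • z := by rw [mul_comm, haz]
  have hzy : z * y = y * z := mul_comm _ _
  rw [zero_smul] at hay
  have hyz := ha.zero_half y hy z hz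
  have hyy := ha.zero_zero y hy y hy
  obtain ⟨w, hw, hzz⟩ := ha.half_mul_half hz hz
  have hidem := hb.idem
  have hba : B (α • a + y + z) a = α := by
    simp only [map_add, map_smul, LinearMap.add_apply, LinearMap.smul_apply, ha.normalized,
      ha.symm y, ha.symm z, ha.form_zero hy, ha.form_half h2 hz]
    simp
  have hmm := hb.mul_mul h2 a
  rw [hba] at hmm
  have h4 : (4 : F) ≠ 0 := by
    have := mul_ne_zero h2 h2
    norm_num at this
    exact this
  simp only [add_mul, mul_add, smul_mul_assoc, mul_smul_comm, hay, haz, hya, hza, hzy, ha.idem, hzz,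
    smul_zero, add_zero, zero_add] at hidem hmm
  -- Write z² = ½(z, z)a + w with w in A_0(a). The components of b² = b at a, in A_0(a) and in
  -- A_{1/2}(a) are α² + ½(z, z) = α, y² + w = y and αz + 2yz = z.
  obtain ⟨h1, h3, h5⟩ := ha.components_eq h2 (t := α ^ 2 + B z z / 2) (y := y * y + w)
    (z := α • z + (2 : F) • (y * z)) (add_mem hyy hw)
    (add_mem (Submodule.smul_mem _ _ hz) (Submodule.smul_mem _ _ hyz)) hy hz (by
      rw [← hidem]
      match_scalars <;> field_simp <;> ring)
  have hyz' : y * z = ((1 - α) / 2) • z := by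
    have : y * z = (1 / 2 : F) • (α • z + (2 : F) • (y * z)) - (α / 2) • z := by
      match_scalars <;> field_simp <;> ring
    rw [this, h5]
    match_scalars; field_simp
  -- The A_0(a)-component of b(ba) = ½ ba + ½αb reads ½w = ½αy, which separates w from y² in the
  -- relation y² + w = y.
  obtain ⟨h6, h7, -⟩ := ha.components_eq h2 (t := α ^ 2 + B z z / 4) (y := (1 / 2 : F) • w)
    (z := ((1 + 2 * α) / 4) • z) (t' := (α ^ 2 + α) / 2)
    (y' := (α / 2) • y) (z' := (α / 2 + 1 / 4 : F) • z)
    (Submodule.smul_mem _ _ hw) (Submodule.smul_mem _ _ hz)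
    (Submodule.smul_mem _ _ hy) (Submodule.smul_mem _ _ hz) (by
      rw [hyz'] at hmm
      convert hmm using 1 <;> match_scalars <;> field_simp <;> ring)
  have hw' : w = α • y := by
    have : w = (2 : F) • ((1 / 2 : F) • w) := by
      match_scalars; field_simp
    rw [this, h7]
    match_scalars; field_simp
  have hzz' : B z z = 2 * (α - α ^ 2) := by
    field_simp at h1
    linear_combination h1
  refine ⟨hyz', ?_, ?_, hzz', ?_⟩
  · rw [hzz, hzz', hw']
    match_scalars <;> field_simp
  · rw [hw'] at h3
    rw [eq_sub_of_add_eq h3]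
    module
  · have h := hb.normalized
    simp only [map_add, map_smul, LinearMap.add_apply, LinearMap.smul_apply, ha.normalized,
      ha.symm y a, ha.symm z a, ha.form_zero hy, ha.form_half h2 hz, ha.form_zero_half h2 hy hz,
      ha.symm z y, hzz', smul_eq_mul] at h
    linear_combination h

end IsNormalizedAxis

end Peirce

/-! ### Spanning sets and the decomposable case -/

section Classification

variable {F : Type*} [Field F] {A : Type*} [NonUnitalNonAssocCommRing A] [Module F A]
  [SMulCommClass F A A] [IsScalarTower F A A]

set_option linter.unusedSectionVars false

theorem span_eq_top_of_mul_mem {X S : Set A} (hX : NonUnitalAlgebra.adjoin F X = ⊤)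
    (hXS : X ⊆ Submodule.span F S)
    (hS : ∀ s ∈ S, ∀ t ∈ S, s * t ∈ Submodule.span F S) : Submodule.span F S = ⊤ := by
  have hmul : ∀ x ∈ Submodule.span F S, ∀ y ∈ Submodule.span F S, x * y ∈ Submodule.span F S := by
    intro x hx y hy
    induction hx using Submodule.span_induction with
    | zero => simp
    | add x x' _ _ h h' => rw [add_mul]; exact add_mem h h'
    | smul r x _ h => rw [smul_mul_assoc]; exact Submodule.smul_mem _ _ h
    | mem x hx =>
      induction hy using Submodule.span_induction with
      | zero => simp
      | add y y' _ _ h h' => rw [mul_add]; exact add_mem h h'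
      | smul r y _ h => rw [mul_smul_comm]; exact Submodule.smul_mem _ _ h
      | mem y hy => exact hS x hx y hy
  rw [eq_top_iff]
  intro x _
  have hx : x ∈ NonUnitalAlgebra.adjoin F X := hX ▸ trivial
  induction hx using NonUnitalAlgebra.adjoin_induction with
  | mem x hx => exact hXS hx
  | zero => exact zero_mem _
  | add x y _ _ h h' => exact add_mem (h trivial) (h' trivial)
  | mul x y _ _ h h' => exact hmul _ (h trivial) _ (h' trivial)
  | smul r x _ h => exact Submodule.smul_mem _ _ (h trivial)

theorem exists_combination {v : Fin 4 → A} (hv : Submodule.span F (Set.range v) = ⊤) (x : A) :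
    ∃ s t p q : F, x = s • v 0 + t • v 1 + p • v 2 + q • v 3 := by
  have hx : x ∈ Submodule.span F (Set.range v) := hv ▸ Submodule.mem_top
  obtain ⟨g, rfl⟩ := (Submodule.mem_span_range_iff_exists_fun F).1 hx
  exact ⟨g 0, g 1, g 2, g 3, by rw [Fin.sum_univ_four]⟩

variable {V : Type*} [AddCommGroup V] [Module F V] {χ : LinearMap.BilinForm F V}

/-- The hypotheses prescribe all products of e, u and the image of h, so they define a homomorphism
from F ⊕ J(χ). Both sides have dimension 4, so surjectivity alone gives bijectivity. -/
theorem algIso_prod_jForm (hA : finrank F A = 4) (hV : finrank F V = 2) {e u : A} {h : V →ₗ[F] A}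
    (he : e * e = e) (heu : e * u = 0) (heh : ∀ v, e * h v = 0) (huu : u * u = u)
    (hu : ∀ v, u * h v = h v) (hh : ∀ v w, h v * h w = χ v w • u)
    (hsurj : ∀ x : A, ∃ (s t : F) (v : V), x = s • e + t • u + h v) :
    AlgIso F A (F × JForm χ) := by
  have : FiniteDimensional F A := FiniteDimensional.of_finrank_pos (by omega)
  have : FiniteDimensional F V := FiniteDimensional.of_finrank_pos (by omega)
  have hd : finrank F (F × JForm χ) = 4 := by
    change finrank F (F × (F × V)) = 4
    rw [finrank_prod, finrank_prod, hV, finrank_self]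
  have : FiniteDimensional F (F × JForm χ) := FiniteDimensional.of_finrank_pos (by omega)
  let g : (F × JForm χ) →ₗ[F] A :=
    (LinearMap.toSpanSingleton F A e).coprod (JForm.lift u h)
  have hg : ∀ x, g x = x.1 • e + JForm.lift u h x.2 := fun x => by simp [g]
  have hsur : Function.Surjective g := by
    intro x
    obtain ⟨s, t, v, rfl⟩ := hsurj x
    refine ⟨(s, JForm.mk χ t v), ?_⟩
    rw [hg, JForm.lift_apply, add_assoc]
    rfl
  have hinj := (LinearMap.injective_iff_surjective_of_finrank_eq_finrank (hd.trans hA.symm)).2 hsur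
  refine AlgIso.symm ⟨LinearEquiv.ofBijective g ⟨hinj, hsur⟩, fun x y => ?_⟩
  have hel : ∀ z : JForm χ, e * JForm.lift u h z = 0 := fun z => by
    rw [JForm.lift_apply, mul_add, mul_smul_comm, heu, heh, smul_zero, add_zero]
  have hle : ∀ z : JForm χ, JForm.lift u h z * e = 0 := fun z => by rw [mul_comm, hel]
  change g (x * y) = g x * g y
  rw [hg, hg, hg, Prod.fst_mul, Prod.snd_mul,
    JForm.lift_mul huu hu (fun v => by rw [mul_comm, hu]) hh]
  simp only [mul_add, add_mul, smul_mul_assoc, mul_smul_comm, hel, hle, he]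
  module

/-- The diagonal bilinear form `⟨1, δ⟩` on `F²`. -/
def diagForm (δ : F) : LinearMap.BilinForm F (Fin 2 → F) :=
  Matrix.toBilin' (Matrix.diagonal ![1, δ])

theorem diagForm_apply (δ : F) (v w : Fin 2 → F) :
    diagForm δ v w = v 0 * w 0 + δ * v 1 * w 1 := by
  simp [diagForm, Matrix.toBilin'_apply', dotProduct, Fin.sum_univ_two, Matrix.mulVec_diagonal]
  ring

theorem diagForm_nondegenerate {δ : F} (hδ : δ ≠ 0) (v : Fin 2 → F)
    (h : ∀ w, diagForm δ v w = 0) : v = 0 := by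
  have h0 := h (Pi.single 0 1)
  have h1 := h (Pi.single 1 1)
  simp only [diagForm_apply] at h0 h1
  funext i
  fin_cases i
  · simpa using h0
  · simpa [hδ] using h1

variable {B : LinearMap.BilinForm F A}

section Decomposable

/-- If the `0`-eigenspace of `a` contains an element outside the `0`-component of `b`, the algebra
is the sum of a field and a Jordan algebra of a nondegenerate form. -/
theorem algIso_prod_of_zero_component [Invertible (2 : F)] {a y z d₀ : A} {α : F}
    (ha : IsNormalizedAxis B a)
    (hnd : ∀ x, (∀ w, B x w = 0) → x = 0) (hA : finrank F A = 4)
    (hd : ∀ x : A, (∀ w, x * w = 0) → x = 0)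
    (hy : y ∈ axisEigenspace F a (0 : F)) (hz : z ∈ axisEigenspace F a (1 / 2 : F))
    (hb : IsNormalizedAxis B (α • a + y + z)) (hy0 : y ≠ 0) (hz0 : z ≠ 0)
    (hd₀ : d₀ ∈ axisEigenspace F a (0 : F)) (hd₀y : ∀ r : F, d₀ ≠ r • y) :
    ∃ δ : F, δ ≠ 0 ∧ AlgIso F A (F × JForm (diagForm δ)) := by
  have h2 : (2 : F) ≠ 0 := two_ne_zero_of_invertible
  have : FiniteDimensional F A := FiniteDimensional.of_finrank_pos (by omega)
  obtain ⟨hyz, hzz, hyy, hBzz, hByy⟩ := ha.axis_components h2 hy hz hb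
  have hli : LinearIndependent F ![a, y, z, d₀] := by
    rw [Fintype.linearIndependent_iff]
    intro g hg
    rw [Fin.sum_univ_four] at hg
    simp only [Matrix.cons_val] at hg
    obtain ⟨h1, h3, h4⟩ := ha.eq_zero_of_components h2 (t := g 0) (y := g 1 • y + g 3 • d₀)
      (z := g 2 • z) (add_mem (Submodule.smul_mem _ _ hy) (Submodule.smul_mem _ _ hd₀))
      (Submodule.smul_mem _ _ hz) (by rw [← hg]; abel)
    have h6 : g 3 = 0 := by
      by_contra h6
      refine hd₀y (-(g 3)⁻¹ * g 1) ?_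
      have : d₀ = (g 3)⁻¹ • (g 1 • y + g 3 • d₀) + (-(g 3)⁻¹ * g 1) • y := by
        match_scalars <;> field_simp
        ring
      rw [this, h3, smul_zero, zero_add]
    have h5 : g 1 = 0 := by
      rw [h6, zero_smul, add_zero] at h3
      exact (smul_eq_zero.1 h3).resolve_right hy0
    have h7 : g 2 = 0 := (smul_eq_zero.1 h4).resolve_right hz0
    intro i
    fin_cases i <;> assumption
  have hspan₀ : ∀ x : A, ∃ s t p q : F, x = s • a + t • y + p • z + q • d₀ :=
    exists_combination (hli.span_eq_top_of_card_eq_finrank (by simp [hA]))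
  -- z is orthogonal to a, y and d₀, so (z, z) = 0 would put it in the radical. As (z, z) = 2α(1 -
  -- α), this excludes α = 0 and α = 1.
  have hBz0 : B z z ≠ 0 := by
    intro h0
    refine hz0 (hnd _ fun w => ?_)
    obtain ⟨s, t, p, q, rfl⟩ := hspan₀ w
    simp only [map_add, map_smul, LinearMap.add_apply, LinearMap.smul_apply, h0, ha.symm z, ha.form_half h2 hz, ha.form_zero_half h2 hy hz,
      ha.form_zero_half h2 hd₀ hz, smul_zero, add_zero]
  rw [hBzz] at hBz0
  have hα0 : α ≠ 0 := by
    rintro rfl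
    simp at hBz0
  have hα1 : 1 - α ≠ 0 := by
    intro h
    apply hBz0
    linear_combination 2 * α * h
  -- Gram–Schmidt in A_0(a), using (y, y) = (1 - α)² ≠ 0.
  set d := d₀ - (B d₀ y / (1 - α) ^ 2) • y with hdd
  have hdm : d ∈ axisEigenspace F a (0 : F) := sub_mem hd₀ (Submodule.smul_mem _ _ hy)
  have hdy : B d y = 0 := by
    rw [hdd, map_sub, map_smul, LinearMap.sub_apply, LinearMap.smul_apply, hByy, smul_eq_mul]
    field_simp
    ring
  have hd0 : d ≠ 0 := fun h => hd₀y _ (sub_eq_zero.1 h)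
  have hspan : ∀ x : A, ∃ s t p q : F, x = s • a + t • y + p • z + q • d := by
    intro x
    obtain ⟨s, t, p, q, rfl⟩ := hspan₀ x
    refine ⟨s, t + q * (B d₀ y / (1 - α) ^ 2), p, q, ?_⟩
    rw [hdd]
    module
  have hzero : ∀ x ∈ axisEigenspace F a (0 : F), ∃ t q : F, x = t • y + q • d := by
    intro x hx
    obtain ⟨s, t, p, q, h⟩ := hspan x
    obtain ⟨-, h, -⟩ := ha.components_eq h2 (t := 0) (t' := s) (z := 0) hx (zero_mem _)
      (add_mem (Submodule.smul_mem _ t hy) (Submodule.smul_mem _ q hdm))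
      (Submodule.smul_mem _ p hz) (by rw [zero_smul, zero_add, add_zero, h]; abel)
    exact ⟨t, q, h⟩
  have hhalf : ∀ x ∈ axisEigenspace F a (1 / 2 : F), ∃ p : F, x = p • z := by
    intro x hx
    obtain ⟨s, t, p, q, h⟩ := hspan x
    obtain ⟨-, -, h⟩ := ha.components_eq h2 (t := 0) (t' := s) (y := 0) (zero_mem _) hx
      (add_mem (Submodule.smul_mem _ t hy) (Submodule.smul_mem _ q hdm))
      (Submodule.smul_mem _ p hz) (by rw [zero_smul, zero_add, zero_add, h]; abel)
    exact ⟨p, h⟩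
  have hBd0 : B d d ≠ 0 := by
    intro h0
    refine hd0 (hnd _ fun w => ?_)
    obtain ⟨s, t, p, q, rfl⟩ := hspan w
    simp only [map_add, map_smul, h0, hdy, ha.symm d a, ha.form_zero hdm,
      ha.form_zero_half h2 hdm hz, smul_zero, add_zero]
  have hda : d * a = 0 := by rw [mul_comm, mem_axisEigenspace.1 hdm, zero_smul]
  have hza : z * a = (1 / 2 : F) • z := by rw [mul_comm, mem_axisEigenspace.1 hz]
  have hya : y * a = 0 := by rw [mul_comm, mem_axisEigenspace.1 hy, zero_smul]
  -- A_{1/2}(a) = Fz, so dz = pz. Here (dz, z) = (z², d) = 0 because z² is a combination of a and y,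
  -- both orthogonal to d.
  have hdz : d * z = 0 := by
    obtain ⟨p, hp⟩ := hhalf _ (ha.zero_half _ hdm _ hz)
    have h : B (d * z) z = 0 := by
      rw [mul_comm, ha.assoc, ha.symm, hzz, map_add, map_smul, map_smul, hdy, ha.symm d,
        ha.form_zero hdm, smul_zero, smul_zero, add_zero]
    rw [hp, map_smul, LinearMap.smul_apply, smul_eq_mul, hBzz] at h
    rw [hp, (mul_eq_zero.1 h).resolve_right hBz0, zero_smul]
  -- dy lies in the span of y and d, and (dy, y) = (y², d) = (1 - α)(y, d) = 0 removes the y-part.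
  obtain ⟨ε, hε⟩ : ∃ ε : F, d * y = ε • d := by
    obtain ⟨t, q, h⟩ := hzero _ (ha.zero_zero _ hdm _ hy)
    have h' : B (d * y) y = 0 := by
      rw [mul_comm, ha.assoc, hyy, map_smul, LinearMap.smul_apply, ha.symm, hdy, smul_zero]
    rw [h, map_add, map_smul, map_smul, LinearMap.add_apply, LinearMap.smul_apply,
      LinearMap.smul_apply, hdy, hByy, smul_zero, add_zero, smul_eq_mul] at h'
    rw [(mul_eq_zero.1 h').resolve_right (pow_ne_zero 2 hα1), zero_smul, zero_add] at h
    exact ⟨q, h⟩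
  obtain ⟨p, q, hpq⟩ := hzero _ (ha.zero_zero _ hdm _ hdm)
  have hBddy : B (d * d) y = ε * B d d := by
    rw [ha.assoc, hε, map_smul, LinearMap.smul_apply, smul_eq_mul]
  have hp : p * (1 - α) ^ 2 = ε * B d d := by
    rw [← hBddy, hpq, map_add, map_smul, map_smul, LinearMap.add_apply, LinearMap.smul_apply,
      LinearMap.smul_apply, hdy, hByy, smul_zero, add_zero, smul_eq_mul]
  set b := α • a + y + z with hbdef
  have hbd : b * d = ε • d := by
    rw [hbdef, add_mul, add_mul, smul_mul_assoc, mul_comm a, hda, mul_comm y, hε, mul_comm z, hdz,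
      smul_zero, zero_add, add_zero]
  have hBbd : B b d = 0 := by
    rw [hbdef, map_add, map_add, map_smul, LinearMap.add_apply, LinearMap.add_apply,
      LinearMap.smul_apply, ha.form_zero hdm, ha.symm y d, hdy, ha.symm z d,
      ha.form_zero_half h2 hdm hz, smul_zero, add_zero, add_zero]
  -- d is an eigenvector of the axis b orthogonal to b, so b(bd) = ½ bd.
  have hεε : ε * (ε - 1 / 2) = 0 := by
    have h := hb.mul_mul h2 d
    rw [hBbd, hbd, mul_smul_comm, hbd, zero_div, zero_smul, add_zero, ← sub_eq_zero, smul_smul,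
      smul_smul, ← sub_smul] at h
    have := (smul_eq_zero.1 h).resolve_right hd0
    linear_combination this
  -- If ε = 1/2, then d is in A_{1/2}(b), so d² is in A_0(b) ⊕ A_1(b). This forces (d², d) = 0,
  -- hence d² = py with p ≠ 0, and b(by) = by. Pairing the last equation with a gives α(1 - α)² = 0,
  -- a contradiction.
  have hε0 : ε = 0 := by
    by_contra hε0
    have hε2 : ε = 1 / 2 := sub_eq_zero.1 ((mul_eq_zero.1 hεε).resolve_left hε0)
    have hdb : d ∈ axisEigenspace F b (1 / 2 : F) := by
      rw [mem_axisEigenspace, hbd, hε2]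
    obtain ⟨w, hw, hddw⟩ := hb.half_mul_half hdb hdb
    have hBddd : B (d * d) d = 0 := by
      rw [hddw, map_add, map_smul, LinearMap.add_apply, LinearMap.smul_apply, hBbd,
        hb.form_zero_half h2 hw hdb, smul_zero, add_zero]
    have hq : q = 0 := by
      rw [hpq, map_add, map_smul, map_smul, LinearMap.add_apply, LinearMap.smul_apply,
        LinearMap.smul_apply, ha.symm y d, hdy, smul_zero, zero_add, smul_eq_mul] at hBddd
      exact (mul_eq_zero.1 hBddd).resolve_right hBd0
    rw [hq, zero_smul, add_zero] at hpq
    have hp0 : p ≠ 0 := by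
      rintro rfl
      rw [zero_mul] at hp
      exact mul_ne_zero hε0 hBd0 hp.symm
    have hbb : b * (b * (d * d)) = b * (d * d) := by
      rw [hddw, mul_add, mul_smul_comm, hb.idem, mem_axisEigenspace.1 hw, zero_smul, add_zero,
        mul_smul_comm, hb.idem]
    rw [hpq, mul_smul_comm, mul_smul_comm] at hbb
    have hbb := smul_right_injective _ hp0 hbb
    have hby : b * y = (1 - α) • y + ((1 - α) / 2) • z := by
      rw [hbdef, add_mul, add_mul, smul_mul_assoc, mul_comm a, hya, hyy, mul_comm z, hyz, smul_zero,
        zero_add]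
    have hbz : B a (b * z) = α - α ^ 2 := by
      rw [hbdef, add_mul, add_mul, smul_mul_assoc, mul_comm a, hza, hyz, hzz]
      simp only [map_add, map_smul, ha.normalized, ha.form_zero hy, ha.form_half h2 hz]
      simp
    rw [hby] at hbb
    have h := congrArg (B a) hbb
    rw [mul_add, mul_smul_comm, mul_smul_comm, hby] at h
    simp only [map_add, map_smul, hbz, ha.form_zero hy, ha.form_half h2 hz] at h
    have h' : α * (1 - α) ^ 2 = 0 := by
      simp only [smul_eq_mul] at h
      field_simp at h
      linear_combination (1 - α) * h
    exact mul_ne_zero hα0 (pow_ne_zero 2 hα1) h'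
  rw [hε0, zero_smul] at hε
  have hp0 : p = 0 := by
    rw [hε0, zero_mul] at hp
    exact (mul_eq_zero.1 hp).resolve_right (pow_ne_zero 2 hα1)
  rw [hp0, zero_smul, zero_add] at hpq
  -- Otherwise d would annihilate the whole algebra.
  have hq0 : q ≠ 0 := by
    rintro rfl
    rw [zero_smul] at hpq
    refine hd0 (hd _ fun w => ?_)
    obtain ⟨s, t, p, q, rfl⟩ := hspan w
    simp only [mul_add, mul_smul_comm, hda, hdz, hε, hpq, smul_zero, add_zero]
  -- With f = y/(1 - α), the elements a and f are orthogonal idempotents, each acting as 1/2 on z.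
  -- Hence a + f is the unit of the second summand, (a - f)² = a + f and z² = α(1 - α)(a + f).
  refine ⟨α * (1 - α), mul_ne_zero hα0 hα1, algIso_prod_jForm hA (by simp) (e := q⁻¹ • d)
    (u := a + (1 - α)⁻¹ • y)
    (h := (LinearMap.toSpanSingleton F A (a - (1 - α)⁻¹ • y)).comp (LinearMap.proj 0) +
      (LinearMap.toSpanSingleton F A z).comp (LinearMap.proj 1)) ?_ ?_ ?_ ?_ ?_ ?_ ?_⟩
  · rw [smul_mul_assoc, mul_smul_comm, hpq, smul_smul q⁻¹ q, inv_mul_cancel₀ hq0, one_smul]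
  · simp only [smul_mul_assoc, mul_smul_comm, mul_add, hda, hε, smul_zero, add_zero]
  · intro v
    simp only [LinearMap.add_apply, LinearMap.comp_apply, LinearMap.toSpanSingleton_apply,
      smul_mul_assoc, mul_smul_comm, mul_add, mul_sub, hda, hε, hdz, smul_zero, add_zero, sub_zero]
  · simp only [smul_mul_assoc, mul_smul_comm, mul_add, add_mul, ha.idem, hya, mul_comm a y, hyy]
    match_scalars <;> field_simp
  · intro v
    simp only [LinearMap.add_apply, LinearMap.comp_apply, LinearMap.toSpanSingleton_apply,
      LinearMap.proj_apply, smul_mul_assoc, mul_smul_comm, mul_add, mul_sub, add_mul, ha.idem, hya,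
      mul_comm a y, hyy, mul_comm a z, hza, hyz]
    match_scalars <;> field_simp <;> ring
  · intro v w
    simp only [LinearMap.add_apply, LinearMap.comp_apply, LinearMap.toSpanSingleton_apply,
      LinearMap.proj_apply, smul_mul_assoc, mul_smul_comm, mul_add, mul_sub, add_mul, sub_mul,
      ha.idem, hya, mul_comm a y, hyy, mul_comm a z, hza, hyz, mul_comm z y, hzz, diagForm_apply]
    match_scalars <;> field_simp <;> ring
  · intro x
    obtain ⟨s, t, p, r, rfl⟩ := hspan x
    refine ⟨r * q, (s + t * (1 - α)) / 2, ![(s - t * (1 - α)) / 2, p], ?_⟩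
    simp only [LinearMap.add_apply, LinearMap.comp_apply, LinearMap.toSpanSingleton_apply,
      LinearMap.proj_apply, Matrix.cons_val]
    match_scalars <;> field_simp <;> ring

end Decomposable

end Classification

/-! ### The spin factor case and the classification in dimension 4 -/

section Spin

variable {F : Type*} [Field F] {A : Type*} [NonUnitalNonAssocCommRing A] [Module F A]
  [SMulCommClass F A A] [IsScalarTower F A A]

set_option linter.unusedSectionVars false

variable {B : LinearMap.BilinForm F A}

/-- The bilinear form `(s, x), (t, w) ↦ s t + B x w / 2` on `F ⊕ A_{1/2}(a)`. -/
def spinForm (B : LinearMap.BilinForm F A) (a : A) :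
    LinearMap.BilinForm F (F × axisEigenspace F a (1 / 2 : F)) :=
  LinearMap.mk₂ F (fun x y => x.1 * y.1 + B x.2 y.2 / 2)
    (fun x x' y => by
      simp only [Prod.fst_add, Prod.snd_add, Submodule.coe_add, map_add, LinearMap.add_apply]
      ring)
    (fun r x y => by
      simp only [Prod.smul_fst, Prod.smul_snd, Submodule.coe_smul, map_smul, LinearMap.smul_apply,
        smul_eq_mul]
      ring)
    (fun x y y' => by
      simp only [Prod.fst_add, Prod.snd_add, Submodule.coe_add, map_add]
      ring)
    (fun r x y => by
      simp only [Prod.smul_fst, Prod.smul_snd, Submodule.coe_smul, map_smul, smul_eq_mul]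
      ring)

theorem spinForm_apply (a : A) (x y : F × axisEigenspace F a (1 / 2 : F)) :
    spinForm B a x y = x.1 * y.1 + B (x.2 : A) y.2 / 2 := rfl

/-- An algebra with nondegenerate associating form in which the Peirce spaces of the axis `a` are
those of a Jordan algebra of a bilinear form. -/
theorem algIso_spinForm (h2 : (2 : F) ≠ 0) {a f : A} (ha : IsNormalizedAxis B a)
    (hnd : ∀ x, (∀ w, B x w = 0) → x = 0)
    (hf : f ∈ axisEigenspace F a (0 : F)) (hff : f * f = f) (hBf : B f f = 1)
    (h0 : ∀ x ∈ axisEigenspace F a (0 : F), ∃ r : F, x = r • f)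
    (hh : ∀ x ∈ axisEigenspace F a (1 / 2 : F), f * x = (1 / 2 : F) • x) :
    AlgIso F A (JForm (spinForm B a)) ∧
      ∀ x, (∀ y, spinForm B a x y = 0) → x = 0 := by
  have hfa : f * a = 0 := by rw [mul_comm, mem_axisEigenspace.1 hf, zero_smul]
  have haf : a * f = 0 := by rw [mul_comm, hfa]
  have hf0 : f ≠ 0 := by
    rintro rfl
    simp at hBf
  -- In xy = ½(x, y)a + rf, pairing with f gives r = (f, xy) = (fx, y) = ½(x, y).
  have hmul : ∀ x ∈ axisEigenspace F a (1 / 2 : F), ∀ y ∈ axisEigenspace F a (1 / 2 : F),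
      x * y = (B x y / 2) • (a + f) := by
    intro x hx y hy
    obtain ⟨z, hz, hxy⟩ := ha.half_mul_half hx hy
    obtain ⟨r, rfl⟩ := h0 z hz
    have hr : B f (x * y) = B x y / 2 := by
      rw [ha.mul_right, hh x hx, map_smul, LinearMap.smul_apply, smul_eq_mul]
      ring
    rw [hxy, map_add, map_smul, map_smul, ha.symm f a, ha.form_zero hf, smul_zero, zero_add, hBf,
      smul_eq_mul, mul_one] at hr
    rw [hxy, hr, smul_add]
  refine ⟨AlgIso.symm ⟨LinearEquiv.ofBijective (JForm.lift (a + f)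
      ((LinearMap.toSpanSingleton F A (a - f)).coprod (Submodule.subtype _))) ⟨?_, ?_⟩,
      JForm.lift_mul ?_ ?_ ?_ ?_⟩, ?_⟩
  · rw [← LinearMap.ker_eq_bot, LinearMap.ker_eq_bot']
    intro x hx
    rw [JForm.lift_apply, LinearMap.coprod_apply, LinearMap.toSpanSingleton_apply,
      Submodule.subtype_apply] at hx
    obtain ⟨h1, h3, h4⟩ := ha.eq_zero_of_components h2 (t := x.1 + x.2.1)
      (y := (x.1 - x.2.1) • f) (Submodule.smul_mem _ _ hf) x.2.2.2 (by rw [← hx]; module)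
    have h3 := (smul_eq_zero.1 h3).resolve_right hf0
    have h5 : x.1 = 0 := mul_left_cancel₀ h2 (by linear_combination h1 + h3)
    refine JForm.ext h5 (Prod.ext ?_ (Subtype.ext h4))
    change x.2.1 = 0
    linear_combination h1 - h5
  · intro x
    obtain ⟨y, hy, z, hz, hx⟩ := ha.exists_peirce h2 x
    obtain ⟨r, rfl⟩ := h0 y hy
    refine ⟨JForm.mk _ ((B a x + r) / 2) ((B a x - r) / 2, ⟨z, hz⟩), ?_⟩
    change JForm.lift _ _ _ = _
    rw [JForm.lift_apply, LinearMap.coprod_apply, LinearMap.toSpanSingleton_apply,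
      Submodule.subtype_apply, JForm.mk_fst, JForm.mk_snd]
    generalize B a x = t at hx ⊢
    rw [hx]
    match_scalars <;> field_simp <;> ring
  · simp only [mul_add, add_mul, ha.idem, hfa, haf, hff, add_zero, zero_add]
  · rintro ⟨s, x⟩
    simp only [LinearMap.coprod_apply, LinearMap.toSpanSingleton_apply,
      Submodule.subtype_apply, mul_add, add_mul, mul_sub, mul_smul_comm, ha.idem, hfa, haf, hff,
      hh x x.2, mem_axisEigenspace.1 x.2]
    match_scalars <;> field_simp <;> ring
  · rintro ⟨s, x⟩
    rw [mul_comm]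
    simp only [LinearMap.coprod_apply, LinearMap.toSpanSingleton_apply,
      Submodule.subtype_apply, mul_add, add_mul, mul_sub, mul_smul_comm, ha.idem, hfa, haf, hff,
      hh x x.2, mem_axisEigenspace.1 x.2]
    match_scalars <;> field_simp <;> ring
  · rintro ⟨s, x⟩ ⟨t, y⟩
    simp only [LinearMap.coprod_apply, LinearMap.toSpanSingleton_apply,
      Submodule.subtype_apply, mul_add, add_mul, mul_sub, sub_mul, mul_smul_comm, smul_mul_assoc,
      ha.idem, hfa, haf, hff, hh y y.2, mem_axisEigenspace.1 y.2, mul_comm (x : A) a,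
      mul_comm (x : A) f, hh x x.2, mem_axisEigenspace.1 x.2, hmul x x.2 y y.2, spinForm_apply]
    match_scalars <;> field_simp <;> ring
  · rintro ⟨s, x⟩ hx
    have hs : s = 0 := by simpa [spinForm_apply] using hx (1, 0)
    have hx0 : (x : A) = 0 := by
      refine hnd _ fun w => ?_
      obtain ⟨y, hy, z, hz, hw⟩ := ha.exists_peirce h2 w
      have h := hx (0, ⟨z, hz⟩)
      rw [spinForm_apply] at h
      simp only [mul_zero, zero_add, div_eq_zero_iff, h2, or_false] at h
      rw [hw, map_add, map_add, map_smul, h, ha.symm x, ha.form_half h2 x.2, ha.symm x,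
        ha.form_zero_half h2 hy x.2, smul_zero, zero_add, zero_add]
    exact Prod.ext hs (Subtype.ext hx0)

/-- If the `0`-eigenspace of `a` is spanned by the `0`-component of `b`, the algebra is a Jordan
algebra of a nondegenerate form. -/
theorem algIso_mPlus_of_zero_component [Invertible (2 : F)] (hF : ∀ x : F, IsSquare x)
    {a b c y z : A} {α : F}
    (ha : IsNormalizedAxis B a) (hc : IsNormalizedAxis B c)
    (hgen : NonUnitalAlgebra.adjoin F ({a, b, c} : Set A) = ⊤)
    (hnd : ∀ x, (∀ w, B x w = 0) → x = 0) (hA : finrank F A = 4)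
    (hy : y ∈ axisEigenspace F a (0 : F)) (hz : z ∈ axisEigenspace F a (1 / 2 : F))
    (hbyz : b = α • a + y + z) (hb : IsNormalizedAxis B b) (hy0 : y ≠ 0) (hz0 : z ≠ 0)
    (h0 : ∀ x ∈ axisEigenspace F a (0 : F), ∃ r : F, x = r • y) :
    AlgIso F A (MPlus 2 F) := by
  have h2 : (2 : F) ≠ 0 := two_ne_zero_of_invertible
  subst hbyz
  obtain ⟨hyz, hzz, hyy, hBzz, hByy⟩ := ha.axis_components h2 hy hz hb
  -- For α = 1 one has (y, y) = 0, and since A_0(a) = Fy, the vector y would be in the radical.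
  have hα1 : 1 - α ≠ 0 := by
    intro hα
    rw [hα, zero_pow two_ne_zero] at hByy
    refine hy0 (hnd _ fun w => ?_)
    obtain ⟨v, hv, x, hx, hw⟩ := ha.exists_peirce h2 w
    obtain ⟨r, rfl⟩ := h0 v hv
    rw [hw, map_add, map_add, map_smul, map_smul, hByy, ha.symm y, ha.form_zero hy,
      ha.form_zero_half h2 hy hx, smul_zero, smul_zero, add_zero, add_zero]
  obtain ⟨f, hfy⟩ : ∃ f, f = (1 - α)⁻¹ • y := ⟨_, rfl⟩
  have hyf : y = (1 - α) • f := by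
    rw [hfy, smul_smul, mul_inv_cancel₀ hα1, one_smul]
  have hf : f ∈ axisEigenspace F a (0 : F) := hfy ▸ Submodule.smul_mem _ _ hy
  have hff : f * f = f := by
    rw [hfy, smul_mul_assoc, mul_smul_comm, hyy]
    match_scalars
    field_simp
  have hBff : B f f = 1 := by
    rw [hfy, map_smul, map_smul, LinearMap.smul_apply, hByy, smul_eq_mul, smul_eq_mul]
    field_simp
  have hf0 : f ≠ 0 := by
    rintro rfl
    simp at hBff
  have hfz : f * z = (1 / 2 : F) • z := by
    rw [hfy, smul_mul_assoc, hyz]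
    match_scalars
    field_simp
  have h0f : ∀ x ∈ axisEigenspace F a (0 : F), ∃ r : F, x = r • f := by
    intro x hx
    obtain ⟨r, rfl⟩ := h0 x hx
    exact ⟨r * (1 - α), by rw [mul_smul, ← hyf]⟩
  obtain ⟨y', hy', z', hz', hcc⟩ := ha.exists_peirce h2 c
  obtain ⟨hyz', hzz', hyy', hBzz', hByy'⟩ := ha.axis_components h2 hy' hz' (hcc ▸ hc)
  generalize B a c = γ at *
  obtain ⟨k, rfl⟩ := h0f y' hy'
  -- If the A_0(a)-component kf of c is nonzero, this is the relation of `axis_components` for c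
  -- divided by k. For k = 0 that relation is void, and nondegeneracy takes over: γ = 1 and z'² = 0,
  -- and either z' is a multiple of z, or a, f, z, z' is a basis orthogonal to fz' - ½z'.
  have hfz' : f * z' = (1 / 2 : F) • z' := by
    by_cases hk : k = 0
    · subst hk
      rw [zero_smul, LinearMap.map_zero] at hByy'
      have hγ : γ = 1 := by
        have := pow_eq_zero_iff two_ne_zero |>.1 hByy'.symm
        exact (sub_eq_zero.1 this).symm
      subst hγ
      have hzz0 : z' * z' = 0 := by
        rw [hzz', zero_smul, smul_zero, add_zero, one_pow, sub_self, zero_smul]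
      by_cases hr : ∃ r : F, z' = r • z
      · obtain ⟨r, rfl⟩ := hr
        rw [mul_smul_comm, hfz, smul_comm]
      · have hli : LinearIndependent F ![a, f, z, z'] := by
          rw [Fintype.linearIndependent_iff]
          intro g hg
          rw [Fin.sum_univ_four] at hg
          simp only [Matrix.cons_val] at hg
          obtain ⟨h1, h3, h4⟩ := ha.eq_zero_of_components h2 (t := g 0) (y := g 1 • f)
            (z := g 2 • z + g 3 • z') (Submodule.smul_mem _ _ hf)
            (add_mem (Submodule.smul_mem _ _ hz) (Submodule.smul_mem _ _ hz'))
            (by rw [← hg]; abel)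
          have h6 : g 3 = 0 := by
            by_contra h6
            refine hr ⟨-(g 3)⁻¹ * g 2, ?_⟩
            have : z' = (g 3)⁻¹ • (g 2 • z + g 3 • z') + (-(g 3)⁻¹ * g 2) • z := by
              match_scalars <;> field_simp
              ring
            rw [this, h4, smul_zero, zero_add]
          have h5 : g 2 = 0 := by
            rw [h6, zero_smul, add_zero] at h4
            exact (smul_eq_zero.1 h4).resolve_right hz0
          have h7 : g 1 = 0 := (smul_eq_zero.1 h3).resolve_right hf0
          intro i
          fin_cases i <;> assumption
        have : FiniteDimensional F A := FiniteDimensional.of_finrank_pos (by omega)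
        have hspan : ∀ x : A, ∃ s t p q : F, x = s • a + t • f + p • z + q • z' :=
          exists_combination (hli.span_eq_top_of_card_eq_finrank (by simp [hA]))
        have hfzm := ha.zero_half f hf z' hz'
        have hw : f * z' - (1 / 2 : F) • z' ∈ axisEigenspace F a (1 / 2 : F) :=
          sub_mem hfzm (Submodule.smul_mem _ _ hz')
        rw [← sub_eq_zero]
        refine hnd _ fun x => ?_
        obtain ⟨s, t, p, q, rfl⟩ := hspan x
        have e1 : B (f * z' - (1 / 2 : F) • z') a = 0 := by rw [ha.symm, ha.form_half h2 hw]
        have e2 : B (f * z' - (1 / 2 : F) • z') f = 0 := by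
          rw [ha.symm, ha.form_zero_half h2 hf hw]
        have e3 : B (f * z' - (1 / 2 : F) • z') z = 0 := by
          rw [map_sub, LinearMap.sub_apply, ha.assoc, hfz, map_smul, map_smul, LinearMap.smul_apply,
            LinearMap.smul_apply, ha.symm z, sub_self]
        have e4 : B (f * z' - (1 / 2 : F) • z') z' = 0 := by
          rw [map_sub, LinearMap.sub_apply, mul_comm f, ha.assoc, hzz0, map_smul,
            LinearMap.smul_apply, hBzz', map_zero, LinearMap.zero_apply, smul_eq_mul]
          ring
        rw [map_add, map_add, map_add, map_smul, map_smul, map_smul, map_smul, e1, e2, e3, e4]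
        simp
    · have hk1 : k = 1 - γ := by
        rw [smul_mul_assoc, mul_smul_comm, hff, smul_smul, smul_smul, ← sub_eq_zero, ← sub_smul]
          at hyy'
        have := (smul_eq_zero.1 hyy').resolve_right hf0
        exact mul_left_cancel₀ hk (by linear_combination this)
      rw [smul_mul_assoc, ← hk1] at hyz'
      refine smul_right_injective _ hk (?_ : k • (f * z') = k • (1 / 2 : F) • z')
      rw [hyz', smul_smul]
      congr 1
      ring
  have haa := ha.idem
  have haf : a * f = 0 := by rw [mem_axisEigenspace.1 hf, zero_smul]
  have haz := mem_axisEigenspace.1 hz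
  have haz' := mem_axisEigenspace.1 hz'
  -- The span contains the generators and is closed under products, so A_{1/2}(a) is spanned by z
  -- and z', on which f acts as 1/2.
  have hspan : Submodule.span F (Set.range ![a, f, z, z']) = ⊤ := by
    have ma : a ∈ Submodule.span F (Set.range ![a, f, z, z']) := Submodule.subset_span ⟨0, rfl⟩
    have mf : f ∈ Submodule.span F (Set.range ![a, f, z, z']) := Submodule.subset_span ⟨1, rfl⟩
    have mz : z ∈ Submodule.span F (Set.range ![a, f, z, z']) := Submodule.subset_span ⟨2, rfl⟩
    have mz' : z' ∈ Submodule.span F (Set.range ![a, f, z, z']) := Submodule.subset_span ⟨3, rfl⟩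
    have mhalf : ∀ x ∈ axisEigenspace F a (1 / 2 : F), ∀ w ∈ axisEigenspace F a (1 / 2 : F),
        x * w ∈ Submodule.span F (Set.range ![a, f, z, z']) := by
      intro x hx w hw
      obtain ⟨v, hv, h⟩ := ha.half_mul_half hx hw
      obtain ⟨r, rfl⟩ := h0f v hv
      rw [h]
      exact add_mem (Submodule.smul_mem _ _ ma) (Submodule.smul_mem _ _ mf)
    refine span_eq_top_of_mul_mem hgen ?_ ?_
    · rintro x (rfl | rfl | rfl)
      · exact ma
      · rw [hyf]
        exact add_mem (add_mem (Submodule.smul_mem _ _ ma)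
          (Submodule.smul_mem _ _ mf)) mz
      · rw [hcc]
        exact add_mem (add_mem (Submodule.smul_mem _ _ ma) (Submodule.smul_mem _ _ mf)) mz'
    · rintro _ ⟨i, rfl⟩ _ ⟨j, rfl⟩
      have key : ∀ i j : Fin 4, i ≤ j → ![a, f, z, z'] i * ![a, f, z, z'] j ∈
          Submodule.span F (Set.range ![a, f, z, z']) := by
        intro i j hij
        fin_cases i <;> fin_cases j <;> first | exact absurd hij (by decide) | skip
        · change a * a ∈ _
          rwa [haa]
        · change a * f ∈ _
          rw [haf]
          exact zero_mem _
        · change a * z ∈ _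
          rw [haz]
          exact Submodule.smul_mem _ _ mz
        · change a * z' ∈ _
          rw [haz']
          exact Submodule.smul_mem _ _ mz'
        · change f * f ∈ _
          rwa [hff]
        · change f * z ∈ _
          rw [hfz]
          exact Submodule.smul_mem _ _ mz
        · change f * z' ∈ _
          rw [hfz']
          exact Submodule.smul_mem _ _ mz'
        · exact mhalf z hz z hz
        · exact mhalf z hz z' hz'
        · exact mhalf z' hz' z' hz'
      rcases le_total i j with hij | hij
      · exact key i j hij
      · rw [mul_comm]
        exact key j i hij
  have hhalf : ∀ x ∈ axisEigenspace F a (1 / 2 : F), f * x = (1 / 2 : F) • x := by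
    intro x hx
    obtain ⟨s, t, p, q, h⟩ := exists_combination hspan x
    have h : x = s • a + t • f + p • z + q • z' := h
    obtain ⟨-, -, h⟩ := ha.components_eq h2 (t := 0) (t' := s) (y := 0) (zero_mem _) hx
      (Submodule.smul_mem _ t hf)
      (add_mem (Submodule.smul_mem _ p hz) (Submodule.smul_mem _ q hz'))
      (by rw [zero_smul, zero_add, zero_add, h]; abel)
    rw [h, mul_add, mul_smul_comm, mul_smul_comm, hfz, hfz']
    module
  obtain ⟨hiso, hnd'⟩ := algIso_spinForm h2 ha hnd hf hff hBff h0f hhalf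
  refine (hiso.trans ?_).trans (algIso_jForm_mPlus hF)
  have hdim : finrank F (F × axisEigenspace F a (1 / 2 : F)) = 3 := by
    obtain ⟨g, -⟩ := hiso
    have : FiniteDimensional F A := FiniteDimensional.of_finrank_pos (by omega)
    have h := g.finrank_eq
    rw [hA] at h
    change 4 = finrank F (F × (F × axisEigenspace F a (1 / 2 : F))) at h
    rw [finrank_prod, finrank_self] at h
    omega
  refine JForm.algIso hF (n := 3) (by norm_num) hdim (by simp) ?_ hnd' ?_ dotForm_nondegenerate
  · intro x y
    rw [spinForm_apply, spinForm_apply, ha.symm, mul_comm]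
  · intro x y
    rw [dotForm_apply, dotForm_apply]
    ring

/-- Two axes of which one has no `0`- or no `1/2`-component relative to the other span a
subalgebra. -/
theorem mul_mem_span_pair {a b : A} (h2 : (2 : F) ≠ 0)
    {t : F} {y z : A} (ha : a * a = a)
    (hy : y ∈ axisEigenspace F a (0 : F)) (hz : z ∈ axisEigenspace F a (1 / 2 : F))
    (hb : b = t • a + y + z) (h : y = 0 ∨ z = 0) : a * b ∈ Submodule.span F {a, b} := by
  rw [Submodule.mem_span_pair]
  rw [mem_axisEigenspace] at hy hz
  rcases h with rfl | rfl
  · refine ⟨t / 2, 1 / 2, ?_⟩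
    rw [hb, mul_add, mul_add, mul_smul_comm, ha, hz, hy]
    match_scalars <;> field_simp <;> ring
  · refine ⟨t, 0, ?_⟩
    rw [hb, mul_add, mul_add, mul_smul_comm, ha, hz, hy]
    match_scalars <;> ring

theorem algIso_of_peirce_components [Invertible (2 : F)] (hF : ∀ x : F, IsSquare x)
    {a b c y z : A} {α : F}
    (ha : IsNormalizedAxis B a) (hb : IsNormalizedAxis B b) (hc : IsNormalizedAxis B c)
    (hgen : NonUnitalAlgebra.adjoin F ({a, b, c} : Set A) = ⊤)
    (hnd : ∀ x, (∀ w, B x w = 0) → x = 0) (hA : finrank F A = 4)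
    (hy : y ∈ axisEigenspace F a (0 : F)) (hz : z ∈ axisEigenspace F a (1 / 2 : F))
    (hbyz : b = α • a + y + z) (hy0 : y ≠ 0) (hz0 : z ≠ 0) :
    (∃ δ : F, δ ≠ 0 ∧ AlgIso F A (F × JForm (diagForm δ))) ∨ AlgIso F A (MPlus 2 F) := by
  by_cases h : ∀ x ∈ axisEigenspace F a (0 : F), ∃ r : F, x = r • y
  · exact Or.inr (algIso_mPlus_of_zero_component hF ha hc hgen hnd hA hy hz hbyz hb hy0 hz0 h)
  · push Not at h
    obtain ⟨d, hd, hdy⟩ := h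
    refine Or.inl (algIso_prod_of_zero_component ha hnd hA ?_ hy hz (hbyz ▸ hb) hy0 hz0 hd hdy)
    -- An annihilating x is zero: A is generated by idempotents u, and (x, u) = (x, uu) = (xu, u) =
    -- 0; products of elements are treated in the same way.
    intro x hx
    refine hnd x fun w => ?_
    have hw : w ∈ NonUnitalAlgebra.adjoin F ({a, b, c} : Set A) := hgen ▸ trivial
    induction hw using NonUnitalAlgebra.adjoin_induction with
    | mem u hu =>
      have huu : u * u = u := by
        rcases hu with rfl | rfl | rfl
        exacts [ha.idem, hb.idem, hc.idem]
      rw [← huu, ha.mul_right, hx, map_zero, LinearMap.zero_apply]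
    | zero => exact map_zero _
    | add u v _ _ hu hv => rw [map_add, hu, hv, add_zero]
    | mul u v _ _ _ _ => rw [ha.mul_right, hx, map_zero, LinearMap.zero_apply]
    | smul r u _ hu => rw [map_smul, hu, smul_zero]

/-- A 4-dimensional algebra of Jordan type `1/2` generated by three axes, with a nondegenerate
Frobenius form, is `F ⊕ JForm_2(F)` or `M_2^+(F)`. -/
theorem algIso_of_finrank_eq_four [Invertible (2 : F)] (hF : ∀ x : F, IsSquare x) {a b c : A}
    (ha : IsNormalizedAxis B a) (hb : IsNormalizedAxis B b) (hc : IsNormalizedAxis B c)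
    (hgen : NonUnitalAlgebra.adjoin F ({a, b, c} : Set A) = ⊤)
    (hnd : ∀ x, (∀ w, B x w = 0) → x = 0) (hA : finrank F A = 4) :
    (∃ δ : F, δ ≠ 0 ∧ AlgIso F A (F × JForm (diagForm δ))) ∨ AlgIso F A (MPlus 2 F) := by
  have h2 : (2 : F) ≠ 0 := two_ne_zero_of_invertible
  obtain ⟨y₁, hy₁, z₁, hz₁, h₁⟩ := ha.exists_peirce h2 b
  obtain ⟨y₂, hy₂, z₂, hz₂, h₂⟩ := ha.exists_peirce h2 c
  obtain ⟨y₃, hy₃, z₃, hz₃, h₃⟩ := hb.exists_peirce h2 c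
  by_cases c₁ : y₁ = 0 ∨ z₁ = 0
  · by_cases c₂ : y₂ = 0 ∨ z₂ = 0
    · by_cases c₃ : y₃ = 0 ∨ z₃ = 0
      -- All pairwise products of the generators stay in their span, so the dimension is at most 3.
      · exfalso
        have hle : ∀ {S : Set A}, S ⊆ {a, b, c} →
            Submodule.span F S ≤ Submodule.span F {a, b, c} := Submodule.span_mono
        have m₁ := hle (by grind) (mul_mem_span_pair h2 ha.idem hy₁ hz₁ h₁ c₁)
        have m₂ := hle (by grind) (mul_mem_span_pair h2 ha.idem hy₂ hz₂ h₂ c₂)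
        have m₃ := hle (by grind) (mul_mem_span_pair h2 hb.idem hy₃ hz₃ h₃ c₃)
        have ma : a ∈ Submodule.span F {a, b, c} := Submodule.subset_span (by simp)
        have mb : b ∈ Submodule.span F {a, b, c} := Submodule.subset_span (by simp)
        have mc : c ∈ Submodule.span F {a, b, c} := Submodule.subset_span (by simp)
        have htop := span_eq_top_of_mul_mem hgen (S := {a, b, c}) Submodule.subset_span (by
          rintro x (rfl | rfl | rfl) w (rfl | rfl | rfl)
          · rwa [ha.idem]
          · exact m₁
          · exact m₂
          · rwa [mul_comm]
          · rwa [hb.idem]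
          · exact m₃
          · rwa [mul_comm]
          · rwa [mul_comm]
          · rwa [hc.idem])
        classical
        have h := finrank_span_finset_le_card (R := F) ({a, b, c} : Finset A)
        have h' : ((({a, b, c} : Finset A) : Set A)) = {a, b, c} := by simp
        rw [Set.finrank, h', htop, finrank_top, hA] at h
        have := Finset.card_le_three (a := a) (b := b) (c := c)
        omega
      · push Not at c₃
        refine algIso_of_peirce_components hF hb hc ha ?_ hnd hA hy₃ hz₃ h₃ c₃.1 c₃.2
        rw [← hgen]
        congr 1
        grind
    · push Not at c₂
      refine algIso_of_peirce_components hF ha hc hb ?_ hnd hA hy₂ hz₂ h₂ c₂.1 c₂.2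
      rw [← hgen]
      congr 1
      grind
  · push Not at c₁
    exact algIso_of_peirce_components hF ha hb hc hgen hnd hA hy₁ hz₁ h₁ c₁.1 c₁.2

end Spin

/-! ### Uniqueness of the Frobenius form on the universal algebra, and its quotient by the radical
-/

/-- The symmetric multiplication table of the universal algebra. -/
def symmTable {F : Type*} [Field F] (α β γ ψ : F) (i j : Fin 9) : Fin 9 → F :=
  universalTable α β γ ψ (min i j) (max i j)

theorem symmTable_zero {F : Type*} [Field F] (α β γ ψ : F) :
    symmTable α β γ ψ 0 =
      ![![1, 0, 0, 0, 0, 0, 0, 0, 0],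
        ![0, 0, 0, 1, 0, 0, 0, 0, 0],
        ![0, 0, 0, 0, 0, 1, 0, 0, 0],
        ![α / 2, 0, 0, 1 / 2, 0, 0, 0, 0, 0],
        ![0, 0, 0, 0, 0, 0, 1, 0, 0],
        ![γ / 2, 0, 0, 0, 0, 1 / 2, 0, 0, 0],
        ![ψ / 2, 0, 0, 0, 0, 0, 1 / 2, 0, 0],
        ![ψ / 4, 0, 0, γ / 4, 0, α / 4, 1 / 4, 1 / 4, -1 / 4],
        ![ψ / 4, 0, 0, γ / 4, 0, α / 4, 1 / 4, -1 / 4, 1 / 4]] := by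
  funext j
  fin_cases j <;> rfl

theorem symmTable_one {F : Type*} [Field F] (α β γ ψ : F) :
    symmTable α β γ ψ 1 =
      ![![0, 0, 0, 1, 0, 0, 0, 0, 0],
        ![0, 1, 0, 0, 0, 0, 0, 0, 0],
        ![0, 0, 0, 0, 1, 0, 0, 0, 0],
        ![0, α / 2, 0, 1 / 2, 0, 0, 0, 0, 0],
        ![0, β / 2, 0, 0, 1 / 2, 0, 0, 0, 0],
        ![0, 0, 0, 0, 0, 0, 0, 1, 0],
        ![0, ψ / 4, 0, β / 4, α / 4, 0, 1 / 4, 1 / 4, -1 / 4],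
        ![0, ψ / 2, 0, 0, 0, 0, 0, 1 / 2, 0],
        ![0, ψ / 4, 0, β / 4, α / 4, 0, -1 / 4, 1 / 4, 1 / 4]] := by
  funext j
  fin_cases j <;> rfl

theorem symmTable_two {F : Type*} [Field F] (α β γ ψ : F) :
    symmTable α β γ ψ 2 =
      ![![0, 0, 0, 0, 0, 1, 0, 0, 0],
        ![0, 0, 0, 0, 1, 0, 0, 0, 0],
        ![0, 0, 1, 0, 0, 0, 0, 0, 0],
        ![0, 0, 0, 0, 0, 0, 0, 0, 1],
        ![0, 0, β / 2, 0, 1 / 2, 0, 0, 0, 0],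
        ![0, 0, γ / 2, 0, 0, 1 / 2, 0, 0, 0],
        ![0, 0, ψ / 4, 0, γ / 4, β / 4, 1 / 4, -1 / 4, 1 / 4],
        ![0, 0, ψ / 4, 0, γ / 4, β / 4, -1 / 4, 1 / 4, 1 / 4],
        ![0, 0, ψ / 2, 0, 0, 0, 0, 0, 1 / 2]] := by
  funext j
  fin_cases j <;> rfl

/-- Coefficients of `2 * (a * (a * x)) - a * x` at `a`, for the generators `a` and the elements `x`
of the basis. -/
def doubleMulCoeff {F : Type*} [Field F] (α β γ ψ : F) : Fin 3 → Fin 9 → F :=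
  ![![1, α, γ, α, ψ, γ, ψ, (ψ + α * γ) / 2, (ψ + α * γ) / 2],
    ![α, 1, β, α, β, ψ, (ψ + α * β) / 2, ψ, (ψ + α * β) / 2],
    ![γ, β, 1, ψ, β, γ, (ψ + β * γ) / 2, (ψ + β * γ) / 2, ψ]]

set_option maxHeartbeats 4000000 in
-- In coordinates this is a(ax) = ½ ax + ½ (a, x)a for each generator a. It is all that the
-- uniqueness of the Frobenius form needs from the table, besides idempotency of the generators and
-- the expression of the other basis elements as products.
theorem sum_symmTable_mul_symmTable {F : Type*} [Field F] (α β γ ψ : F) (h2 : (2 : F) ≠ 0)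
    (i : Fin 3) (j : Fin 9) :
    ∑ l, symmTable α β γ ψ (i.castLE (by norm_num)) j l •
        symmTable α β γ ψ (i.castLE (by norm_num)) l =
      (1 / 2 : F) • symmTable α β γ ψ (i.castLE (by norm_num)) j +
        (doubleMulCoeff α β γ ψ i j / 2) • Pi.single (i.castLE (by norm_num)) 1 := by
  have h4 : (4 : F) ≠ 0 := by
    have := mul_ne_zero h2 h2
    norm_num at this
    exact this
  have s0 : (Pi.single 0 1 : Fin 9 → F) = ![1, 0, 0, 0, 0, 0, 0, 0, 0] := by
    funext k; fin_cases k <;> rfl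
  have s1 : (Pi.single 1 1 : Fin 9 → F) = ![0, 1, 0, 0, 0, 0, 0, 0, 0] := by
    funext k; fin_cases k <;> rfl
  have s2 : (Pi.single 2 1 : Fin 9 → F) = ![0, 0, 1, 0, 0, 0, 0, 0, 0] := by
    funext k; fin_cases k <;> rfl
  fin_cases i
  · change ∑ l, symmTable α β γ ψ 0 j l • symmTable α β γ ψ 0 l =
      (1 / 2 : F) • symmTable α β γ ψ 0 j + (doubleMulCoeff α β γ ψ 0 j / 2) • Pi.single 0 1
    rw [symmTable_zero, s0]
    fin_cases j <;> simp [Fin.sum_univ_succ, doubleMulCoeff] <;> and_intros <;> field_simp <;> ring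
  · change ∑ l, symmTable α β γ ψ 1 j l • symmTable α β γ ψ 1 l =
      (1 / 2 : F) • symmTable α β γ ψ 1 j + (doubleMulCoeff α β γ ψ 1 j / 2) • Pi.single 1 1
    rw [symmTable_one, s1]
    fin_cases j <;> simp [Fin.sum_univ_succ, doubleMulCoeff] <;> and_intros <;> field_simp <;> ring
  · change ∑ l, symmTable α β γ ψ 2 j l • symmTable α β γ ψ 2 l =
      (1 / 2 : F) • symmTable α β γ ψ 2 j + (doubleMulCoeff α β γ ψ 2 j / 2) • Pi.single 2 1
    rw [symmTable_two, s2]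
    fin_cases j <;> simp [Fin.sum_univ_succ, doubleMulCoeff] <;> and_intros <;> field_simp <;> ring


namespace UniversalAlg

variable {F : Type*} [Field F] {α β γ ψ : F}

variable (α β γ ψ) in
/-- The basis of the universal algebra. -/
def e (i : Fin 9) : UniversalAlg α β γ ψ := (Pi.single i 1 : Fin 9 → F)

theorem e_apply (i k : Fin 9) : e α β γ ψ i k = if k = i then 1 else 0 := by
  simp [e, Pi.single_apply]

theorem sum_smul_e (x : UniversalAlg α β γ ψ) : ∑ i, x i • e α β γ ψ i = x :=
  (pi_eq_sum_univ' (x : Fin 9 → F)).symm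

theorem e_mul_e_apply (i j k : Fin 9) :
    (e α β γ ψ i * e α β γ ψ j) k = symmTable α β γ ψ i j k := by
  rw [mul_apply, Finset.sum_eq_single i, Finset.sum_eq_single j]
  · simp [e_apply, symmTable]
  · intro b _ hb
    simp [e_apply, hb]
  · simp
  · intro b _ hb
    simp [e_apply, hb]
  · simp

theorem e_mul_e (i j : Fin 9) :
    e α β γ ψ i * e α β γ ψ j = ∑ k, symmTable α β γ ψ i j k • e α β γ ψ k := by
  simp only [← e_mul_e_apply, sum_smul_e]

theorem gen_mul_gen_mul (h2 : (2 : F) ≠ 0) (i : Fin 3) (j : Fin 9) :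
    e α β γ ψ (i.castLE (by norm_num)) * (e α β γ ψ (i.castLE (by norm_num)) * e α β γ ψ j) =
      (1 / 2 : F) • (e α β γ ψ (i.castLE (by norm_num)) * e α β γ ψ j) +
        (doubleMulCoeff α β γ ψ i j / 2) • e α β γ ψ (i.castLE (by norm_num)) := by
  have h := sum_symmTable_mul_symmTable α β γ ψ h2 i j
  rw [e_mul_e _ j, Finset.mul_sum]
  simp only [mul_smul_comm]
  have h' : ∀ l, e α β γ ψ (i.castLE (by norm_num)) * e α β γ ψ l =
      (symmTable α β γ ψ (i.castLE (by norm_num)) l : Fin 9 → F) := fun l =>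
    funext fun k => e_mul_e_apply _ _ _
  rw [← e_mul_e]
  simp only [h']
  exact h

/-- An associating symmetric form on the universal algebra that vanishes on the pairs `(a, a)`,
`(b, b)`, `(c, c)` is zero. -/
theorem eq_zero_of_isAssocForm (h2 : (2 : F) ≠ 0)
    {D : LinearMap.BilinForm F (UniversalAlg α β γ ψ)} (hD : IsAssocForm F D)
    (h : ∀ x ∈ gens α β γ ψ, D x x = 0) : D = 0 := by
  have hext : ∀ x, (∀ i, D x (e α β γ ψ i) = 0) → D x = 0 := by
    intro x hx
    ext y
    rw [← sum_smul_e y, map_sum]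
    exact Finset.sum_eq_zero fun i _ => by rw [map_smul, hx, smul_zero]
  have hgen : ∀ i : Fin 3, D (e α β γ ψ (i.castLE (by norm_num))) = 0 := by
    intro i
    set a := e α β γ ψ (i.castLE (by norm_num)) with hadef
    have haa : D a a = 0 := by
      refine h _ ?_
      fin_cases i
      · exact Or.inl rfl
      · exact Or.inr (Or.inl rfl)
      · exact Or.inr (Or.inr rfl)
    have ha : a * a = a := by
      rw [hadef]
      funext k
      rw [e_mul_e_apply, e_apply]
      fin_cases i <;> fin_cases k <;> rfl
    -- Thus D(a, a(ax)) = D(a, x). The identity for a(ax) and D(a, a) = 0 give ½ D(a, x) for the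
    -- same value, so D(a, x) = 0.
    have hmul : ∀ x, D a (a * x) = D a x := fun x => by rw [hD.mul_right, ha]
    refine hext _ fun j => ?_
    have h1 := hmul (a * e α β γ ψ j)
    rw [gen_mul_gen_mul h2, map_add, map_smul, map_smul, haa, smul_zero, add_zero, hmul,
      smul_eq_mul] at h1
    rw [div_mul_eq_mul_div, one_mul, div_eq_iff h2] at h1
    linear_combination -h1
  -- The kernel of D is an ideal; it contains a, b, c and therefore the remaining six basis
  -- elements, which are products.
  have hideal : ∀ x y, D y = 0 → D (x * y) = 0 := by
    intro x y hy
    ext z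
    rw [hD.assoc, hD.symm, hD.mul_right, ← hD.mul_right, hy]
    rfl
  have he : ∀ i j k : Fin 9, symmTable α β γ ψ i j = Pi.single k 1 → D (e α β γ ψ j) = 0 →
      D (e α β γ ψ k) = 0 := by
    intro i j k hk hj
    have : e α β γ ψ k = e α β γ ψ i * e α β γ ψ j := by
      funext l
      rw [e_mul_e_apply, hk]
      rfl
    rw [this]
    exact hideal _ _ hj
  have e0 : D (e α β γ ψ 0) = 0 := hgen 0
  have e1 : D (e α β γ ψ 1) = 0 := hgen 1
  have e2 : D (e α β γ ψ 2) = 0 := hgen 2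
  have e3 := he 0 1 3 (by funext k; fin_cases k <;> rfl) e1
  have e4 := he 1 2 4 (by funext k; fin_cases k <;> rfl) e2
  have e5 := he 0 2 5 (by funext k; fin_cases k <;> rfl) e2
  have e6 := he 0 4 6 (by funext k; fin_cases k <;> rfl) e4
  have e7 := he 1 5 7 (by funext k; fin_cases k <;> rfl) e5
  have e8 := he 2 3 8 (by funext k; fin_cases k <;> rfl) e3
  refine LinearMap.ext fun x => ?_
  rw [← sum_smul_e x, map_sum, LinearMap.zero_apply]
  refine Finset.sum_eq_zero fun i _ => ?_
  rw [map_smul]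
  suffices D (e α β γ ψ i) = 0 by rw [this, smul_zero]
  fin_cases i <;> assumption

end UniversalAlg

open UniversalAlg

/-- An algebra with a nondegenerate associating form that is spanned by elements multiplied as in
the table of the universal algebra is the quotient of the universal algebra by its radical. -/
theorem semisimpleAlg_algIso {F : Type*} [Field F] (h2 : (2 : F) ≠ 0) {α β γ ψ : F} {T : Type*}
    [AddCommGroup T] [Module F T] [Mul T] (m : T →ₗ[F] T →ₗ[F] T) (hm : ∀ x y, m x y = x * y)
    (hcomm : ∀ x y : T, x * y = y * x) (g : Fin 9 → T)
    (hg : ∀ i j, i ≤ j → g i * g j = ∑ k, universalTable α β γ ψ i j k • g k)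
    (D : LinearMap.BilinForm F T) (hsymm : ∀ x y, D x y = D y x)
    (hassoc : ∀ x y z, D (x * y) z = D (x * z) y)
    (hD0 : D (g 0) (g 0) = 1) (hD1 : D (g 1) (g 1) = 1) (hD2 : D (g 2) (g 2) = 1)
    (hnd : ∀ x, (∀ y, D x y = 0) → x = 0)
    (hsurj : ∀ t, ∃ x : Fin 9 → F, ∑ k, x k • g k = t) :
    AlgIso F (SemisimpleAlg α β γ ψ) T := by
  have hg' : ∀ i j, g i * g j = ∑ k, symmTable α β γ ψ i j k • g k := by
    intro i j
    rcases le_total i j with hij | hij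
    · rw [symmTable, min_eq_left hij, max_eq_right hij, hg i j hij]
    · rw [hcomm, symmTable, min_eq_right hij, max_eq_left hij, hg j i hij]
  let π : UniversalAlg α β γ ψ →ₗ[F] T :=
    { toFun := fun x => ∑ k, x k • g k
      map_add' := fun x y => by
        simp only [UniversalAlg.add_apply, add_smul, Finset.sum_add_distrib]
      map_smul' := fun r x => by
        simp only [UniversalAlg.smul_apply, mul_smul, Finset.smul_sum, RingHom.id_apply] }
  have hπ : ∀ x, π x = ∑ k, x k • g k := fun _ => rfl
  have hπe : ∀ i, π (e α β γ ψ i) = g i := by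
    intro i
    rw [hπ, Finset.sum_eq_single i]
    · simp [e_apply]
    · intro b _ hb
      simp [e_apply, hb]
    · simp
  have hπmul : ∀ x y, π (x * y) = π x * π y := by
    intro x y
    rw [← hm]
    have hbil : (LinearMap.mul F (UniversalAlg α β γ ψ)).compr₂ π = m.compl₁₂ π π := by
      refine LinearMap.ext fun x => LinearMap.ext fun y => ?_
      rw [← sum_smul_e x, ← sum_smul_e y]
      simp only [map_sum, map_smul, LinearMap.sum_apply, LinearMap.smul_apply,
        LinearMap.compr₂_apply, LinearMap.compl₁₂_apply, LinearMap.mul_apply', hm, e_mul_e, hπe,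
        hg']
    exact LinearMap.congr_fun (LinearMap.congr_fun hbil x) y
  have hsur : Function.Surjective π := fun t => by
    obtain ⟨x, hx⟩ := hsurj t
    exact ⟨x, hx⟩
  let B : LinearMap.BilinForm F (UniversalAlg α β γ ψ) := D.compl₁₂ π π
  have hB : ∀ x y, B x y = D (π x) (π y) := fun _ _ => rfl
  have hBF : IsFrobeniusForm F (gens α β γ ψ) B := by
    refine ⟨fun x y => hsymm _ _, fun x y z => ?_, ?_⟩
    · rw [hB, hB, hπmul, hπmul, hassoc]
    · rintro x (rfl | rfl | rfl)
      · exact (congrArg₂ (fun s t => D s t) (hπe 0) (hπe 0)).trans hD0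
      · exact (congrArg₂ (fun s t => D s t) (hπe 1) (hπe 1)).trans hD1
      · exact (congrArg₂ (fun s t => D s t) (hπe 2) (hπe 2)).trans hD2
  -- The pullback of D shows that a normalized form exists. The difference of two such forms
  -- vanishes on (a, a), (b, b), (c, c), hence is zero, so the chosen form is the pullback.
  have hfrob : frobeniusForm F (gens α β γ ψ) = B := by
    have hex : ∃ B, IsFrobeniusForm F (gens α β γ ψ) B := ⟨B, hBF⟩
    have h1 : frobeniusForm F (gens α β γ ψ) = hex.choose := dif_pos hex
    have h3 := hex.choose_spec
    rw [h1, ← sub_eq_zero]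
    refine eq_zero_of_isAssocForm h2 ⟨fun x y => ?_, fun x y z => ?_⟩ fun x hx => ?_
    · rw [LinearMap.sub_apply, LinearMap.sub_apply, LinearMap.sub_apply, LinearMap.sub_apply,
        h3.symm, hBF.symm]
    · rw [LinearMap.sub_apply, LinearMap.sub_apply, LinearMap.sub_apply, LinearMap.sub_apply,
        h3.assoc, hBF.assoc]
    · rw [LinearMap.sub_apply, LinearMap.sub_apply, h3.normalized x hx, hBF.normalized x hx,
        sub_self]
  have hker : radical F (gens α β γ ψ) = LinearMap.ker π := by
    ext x
    rw [mem_radical, LinearMap.mem_ker, hfrob]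
    refine ⟨fun h => hnd _ fun t => ?_, fun h y => ?_⟩
    · obtain ⟨y, rfl⟩ := hsur t
      exact h y
    · rw [hB, h, map_zero, LinearMap.zero_apply]
  let f : SemisimpleAlg α β γ ψ ≃ₗ[F] T :=
    (Submodule.quotEquivOfEq _ _ hker).trans (π.quotKerEquivOfSurjective hsur)
  have hf : ∀ x, f (RadicalQuotient.mk F _ x) = π x := fun _ => rfl
  refine ⟨f, fun x y => ?_⟩
  obtain ⟨x, rfl⟩ := RadicalQuotient.mk_surjective x
  obtain ⟨y, rfl⟩ := RadicalQuotient.mk_surjective y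
  rw [← RadicalQuotient.mk_mul, hf, hf, hf, hπmul]

/-! ### Trace forms on Jordan algebras of bilinear forms -/

namespace JForm

variable {F V : Type*} [Field F] [AddCommGroup V] [Module F V] {φ : LinearMap.BilinForm F V}

variable (φ) in
/-- The multiplication of `JForm φ` as a bilinear map. -/
def mulMap : JForm φ →ₗ[F] JForm φ →ₗ[F] JForm φ :=
  LinearMap.mk₂ F (· * ·)
    (fun x x' y => ext
      (by simp only [mul_fst, add_fst, add_snd, map_add, LinearMap.add_apply]; ring)
      (by simp only [mul_snd, add_fst, add_snd]; module))
    (fun r x y => ext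
      (by simp only [mul_fst, smul_fst, smul_snd, map_smul, LinearMap.smul_apply, smul_eq_mul]
          ring)
      (by simp only [mul_snd, smul_fst, smul_snd]; module))
    (fun x y y' => ext
      (by simp only [mul_fst, add_fst, add_snd, map_add]; ring)
      (by simp only [mul_snd, add_fst, add_snd]; module))
    (fun r x y => ext
      (by simp only [mul_fst, smul_fst, smul_snd, map_smul, smul_eq_mul]; ring)
      (by simp only [mul_snd, smul_fst, smul_snd]; module))

theorem mulMap_apply (x y : JForm φ) : mulMap φ x y = x * y := rfl

theorem mul_comm_of_symm (hφ : ∀ v w, φ v w = φ w v) (x y : JForm φ) : x * y = y * x :=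
  ext (by rw [mul_fst, mul_fst, hφ, mul_comm]) (by rw [mul_snd, mul_snd, add_comm])

variable (φ) in
/-- The generic trace form `2 (s t + φ v w)` of `JForm φ`. -/
def traceForm : LinearMap.BilinForm F (JForm φ) :=
  LinearMap.mk₂ F (fun x y => 2 * (x * y).1)
    (fun x x' y => by
      simp only [mul_fst, add_fst, add_snd, map_add, LinearMap.add_apply]; ring)
    (fun r x y => by
      simp only [mul_fst, smul_fst, smul_snd, map_smul, LinearMap.smul_apply, smul_eq_mul]; ring)
    (fun x y y' => by simp only [mul_fst, add_fst, add_snd, map_add]; ring)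
    (fun r x y => by simp only [mul_fst, smul_fst, smul_snd, map_smul, smul_eq_mul]; ring)

theorem traceForm_apply (x y : JForm φ) : traceForm φ x y = 2 * (x.1 * y.1 + φ x.2 y.2) := rfl

theorem traceForm_symm (hφ : ∀ v w, φ v w = φ w v) (x y : JForm φ) :
    traceForm φ x y = traceForm φ y x := by
  rw [traceForm_apply, traceForm_apply, hφ, mul_comm x.1]

theorem traceForm_assoc (hφ : ∀ v w, φ v w = φ w v) (x y z : JForm φ) :
    traceForm φ (x * y) z = traceForm φ (x * z) y := by
  simp only [traceForm_apply, mul_fst, mul_snd, map_add, map_smul, LinearMap.add_apply,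
    LinearMap.smul_apply, smul_eq_mul, hφ z.2 y.2]
  ring

theorem traceForm_nondegenerate (h2 : (2 : F) ≠ 0) (hφ : ∀ v, (∀ w, φ v w = 0) → v = 0)
    (x : JForm φ) (h : ∀ y, traceForm φ x y = 0) : x = 0 := by
  refine ext ?_ (hφ _ fun w => ?_)
  · rw [zero_fst]
    simpa [traceForm_apply, mk_fst, mk_snd, h2] using h (mk φ 1 0)
  · simpa [traceForm_apply, mk_fst, mk_snd, h2] using h (mk φ 0 w)

end JForm

/-! ### The algebras S_7 -/

section SemisimpleQuotients

variable {F : Type*} [Field F]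

/-- The Gram matrix of the traceless parts of three idempotents of rank one. -/
def gramMatrix (α β γ : F) : Matrix (Fin 3) (Fin 3) F :=
  !![1 / 4, (2 * α - 1) / 4, (2 * γ - 1) / 4;
     (2 * α - 1) / 4, 1 / 4, (2 * β - 1) / 4;
     (2 * γ - 1) / 4, (2 * β - 1) / 4, 1 / 4]

/-- The bilinear form with the matrix `gramMatrix`. -/
def gramForm (α β γ : F) : LinearMap.BilinForm F (Fin 3 → F) :=
  Matrix.toBilin' (gramMatrix α β γ)

theorem gramForm_apply (α β γ : F) (v w : Fin 3 → F) :
    gramForm α β γ v w = (v 0 * w 0 + v 1 * w 1 + v 2 * w 2) / 4 +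
      (2 * α - 1) / 4 * (v 0 * w 1 + v 1 * w 0) + (2 * β - 1) / 4 * (v 1 * w 2 + v 2 * w 1) +
      (2 * γ - 1) / 4 * (v 0 * w 2 + v 2 * w 0) := by
  simp [gramForm, gramMatrix, Matrix.toBilin'_apply', dotProduct, Fin.sum_univ_three,
    Matrix.mulVec]
  ring

theorem four_ne_zero_of_two (h2 : (2 : F) ≠ 0) : (4 : F) ≠ 0 := by
  have := mul_ne_zero h2 h2
  norm_num at this
  exact this

/-- Expanding, 64 det = 16αβγ - 4(α + β + γ - 1)², which equals 16(αβγ - ψ²) under the linear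
relation. -/
theorem gramForm_nondegenerate (h2 : (2 : F) ≠ 0) {α β γ ψ : F} (hψ : ψ ^ 2 ≠ α * β * γ)
    (hs : α + β + γ = 2 * ψ + 1) (v : Fin 3 → F) (h : ∀ w, gramForm α β γ v w = 0) : v = 0 := by
  have h4 := four_ne_zero_of_two h2
  refine (LinearMap.BilinForm.nondegenerate_toBilin'_iff_det_ne_zero
    (M := gramMatrix α β γ)).2 ?_ |>.1 v h
  intro hdet
  apply hψ
  rw [Matrix.det_fin_three] at hdet
  simp [gramMatrix] at hdet
  field_simp at hdet
  have h16 : (16 : F) ≠ 0 := by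
    have := mul_ne_zero h4 h4
    norm_num at this
    exact this
  refine mul_left_cancel₀ h16 ?_
  linear_combination -hdet - 4 * (α + β + γ - 1 + 2 * ψ) * hs

/-- The images of the basis of the universal algebra in the Jordan algebra of `gramForm`. -/
def gramElements (α β γ ψ : F) (i : Fin 9) : JForm (gramForm α β γ) :=
  JForm.mk _ (![1 / 2, 1 / 2, 1 / 2, α / 2, β / 2, γ / 2, ψ / 2, ψ / 2, ψ / 2] i)
    (![![1, 0, 0], ![0, 1, 0], ![0, 0, 1], ![1 / 2, 1 / 2, 0], ![0, 1 / 2, 1 / 2],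
      ![1 / 2, 0, 1 / 2], ![β / 2, 1 / 4, 1 / 4], ![1 / 4, γ / 2, 1 / 4],
      ![1 / 4, 1 / 4, α / 2]] i)

theorem JForm.sum_fst {V ι : Type*} [AddCommGroup V] [Module F V] {φ : LinearMap.BilinForm F V}
    (s : Finset ι) (x : ι → JForm φ) : (∑ i ∈ s, x i).1 = ∑ i ∈ s, (x i).1 :=
  map_sum (LinearMap.fst F F V) x s

theorem JForm.sum_snd {V ι : Type*} [AddCommGroup V] [Module F V] {φ : LinearMap.BilinForm F V}
    (s : Finset ι) (x : ι → JForm φ) : (∑ i ∈ s, x i).2 = ∑ i ∈ s, (x i).2 :=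
  map_sum (LinearMap.snd F F V) x s

set_option maxHeartbeats 4000000 in
-- The axes go to ½ + e_i, and `gramForm` is chosen so that the trace form takes the values α, β, γ
-- on pairs of them. Then ab = ½α + ½(e₀ + e₁) and (ab, c) = ½(α + β + γ - 1), so the linear
-- relation says exactly that (ab, c) = ψ.
theorem gramElements_mul (h2 : (2 : F) ≠ 0) {α β γ ψ : F} (hs : α + β + γ = 2 * ψ + 1)
    (i j : Fin 9) (hij : i ≤ j) :
    gramElements α β γ ψ i * gramElements α β γ ψ j =
      ∑ k, universalTable α β γ ψ i j k • gramElements α β γ ψ k := by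
  have h4 := four_ne_zero_of_two h2
  have h8 : (8 : F) ≠ 0 := by
    have := mul_ne_zero h4 h2
    norm_num at this
    exact this
  have h16 : (16 : F) ≠ 0 := by
    have := mul_ne_zero h4 h4
    norm_num at this
    exact this
  obtain rfl : γ = 2 * ψ + 1 - α - β := by linear_combination hs
  have hsum : ∀ t : Fin 9 → F, ∑ k, t k • gramElements α β (2 * ψ + 1 - α - β) ψ k =
      JForm.mk _ (t 0 / 2 + t 1 / 2 + t 2 / 2 + t 3 * α / 2 + t 4 * β / 2 +
          t 5 * (2 * ψ + 1 - α - β) / 2 + (t 6 + t 7 + t 8) * ψ / 2)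
        ![t 0 + t 3 / 2 + t 5 / 2 + t 6 * β / 2 + t 7 / 4 + t 8 / 4,
          t 1 + t 3 / 2 + t 4 / 2 + t 6 / 4 + t 7 * (2 * ψ + 1 - α - β) / 2 + t 8 / 4,
          t 2 + t 4 / 2 + t 5 / 2 + t 6 / 4 + t 7 / 4 + t 8 * α / 2] := by
    intro t
    refine JForm.ext ?_ (funext fun l => ?_)
    · rw [JForm.sum_fst, JForm.mk_fst]
      simp [gramElements, JForm.smul_fst, JForm.mk_fst, Fin.sum_univ_succ]
      ring
    · rw [JForm.sum_snd, JForm.mk_snd, Finset.sum_apply]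
      fin_cases l <;>
      simp [gramElements, JForm.smul_snd, JForm.mk_snd, Fin.sum_univ_succ] <;> ring
  have hmul : ∀ i j, gramElements α β (2 * ψ + 1 - α - β) ψ i *
      gramElements α β (2 * ψ + 1 - α - β) ψ j = _ := fun i j => by
    rw [gramElements, gramElements, JForm.mk_mul_mk, gramForm_apply]
  fin_cases i <;> fin_cases j <;> first
    | exact absurd hij (by decide)
    | (simp only [Fin.zero_eta, Fin.mk_one, Fin.reduceFinMk]
       simp only [universalTable]
       rw [hsum, hmul]
       refine JForm.ext ?_ (funext fun l => ?_)
       · simp only [JForm.mk_fst, Matrix.cons_val]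
         field_simp
         ring
       · rw [JForm.mk_snd, JForm.mk_snd]
         fin_cases l <;> simp <;> field_simp <;> ring)

end SemisimpleQuotients

section SemisimpleQuotients

variable {F : Type*} [Field F]

theorem semisimpleAlg_algIso_gramForm (h2 : (2 : F) ≠ 0) {α β γ ψ : F}
    (hψ : ψ ^ 2 ≠ α * β * γ) (hs : α + β + γ = 2 * ψ + 1) (hα : α ≠ 1) :
    AlgIso F (SemisimpleAlg α β γ ψ) (JForm (gramForm α β γ)) := by
  have h4 := four_ne_zero_of_two h2
  have hsymm : ∀ v w, gramForm α β γ v w = gramForm α β γ w v := fun v w => by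
    rw [gramForm_apply, gramForm_apply]
    ring
  have hnorm : ∀ t : F, t = 1 / 4 → 2 * (1 / 2 * (1 / 2) + t) = 1 := by
    rintro t rfl
    field_simp
    norm_num
  refine semisimpleAlg_algIso h2 (JForm.mulMap _) JForm.mulMap_apply (JForm.mul_comm_of_symm hsymm)
    (gramElements α β γ ψ) (gramElements_mul h2 hs) (JForm.traceForm _)
    (JForm.traceForm_symm hsymm) (JForm.traceForm_assoc hsymm) ?_ ?_ ?_
    (JForm.traceForm_nondegenerate h2 (gramForm_nondegenerate h2 hψ hs)) fun t => ?_
  · refine hnorm _ ?_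
    rw [gramForm_apply]
    simp [gramElements, JForm.mk_snd]
  · refine hnorm _ ?_
    rw [gramForm_apply]
    simp [gramElements, JForm.mk_snd]
  · refine hnorm _ ?_
    rw [gramForm_apply]
    simp [gramElements, JForm.mk_snd]
  -- Since 2ab - a - b is the scalar α - 1, the unit is in the image when α ≠ 1. The vector part of
  -- t is matched by a, b, c, and κ times this scalar corrects the scalar part.
  · have hα' : α - 1 ≠ 0 := sub_ne_zero.2 hα
    obtain ⟨κ, hκ⟩ : ∃ κ, κ * (α - 1) = t.1 - (t.2 0 + t.2 1 + t.2 2) / 2 :=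
      ⟨(t.1 - (t.2 0 + t.2 1 + t.2 2) / 2) / (α - 1), div_mul_cancel₀ _ hα'⟩
    refine ⟨![t.2 0 - κ, t.2 1 - κ, t.2 2, 2 * κ, 0, 0, 0, 0, 0], ?_⟩
    refine JForm.ext ?_ (funext fun l => ?_)
    · rw [JForm.sum_fst]
      simp [gramElements, JForm.smul_fst, JForm.mk_fst, Fin.sum_univ_succ]
      field_simp at hκ ⊢
      linear_combination hκ
    · rw [JForm.sum_snd, Finset.sum_apply]
      fin_cases l <;> simp [gramElements, JForm.smul_snd, JForm.mk_snd, Fin.sum_univ_succ] <;>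
        field_simp <;> ring

/-! ### The algebras S_6 -/

/-- The Gram matrix of the traceless parts of two idempotents of rank one. -/
def gramMatrix₂ (γ : F) : Matrix (Fin 2) (Fin 2) F :=
  !![1 / 4, (2 * γ - 1) / 4; (2 * γ - 1) / 4, 1 / 4]

/-- The bilinear form with the matrix `gramMatrix₂`. -/
def gramForm₂ (γ : F) : LinearMap.BilinForm F (Fin 2 → F) :=
  Matrix.toBilin' (gramMatrix₂ γ)

theorem gramForm₂_apply (γ : F) (v w : Fin 2 → F) :
    gramForm₂ γ v w = (v 0 * w 0 + v 1 * w 1) / 4 + (2 * γ - 1) / 4 * (v 0 * w 1 + v 1 * w 0) := by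
  simp [gramForm₂, gramMatrix₂, Matrix.toBilin'_apply', dotProduct, Fin.sum_univ_two,
    Matrix.mulVec]
  ring

theorem gramForm₂_symm (γ : F) (v w : Fin 2 → F) : gramForm₂ γ v w = gramForm₂ γ w v := by
  rw [gramForm₂_apply, gramForm₂_apply]
  ring

/-- The determinant is γ(1 - γ)/4. -/
theorem gramForm₂_nondegenerate (h2 : (2 : F) ≠ 0) {γ : F} (h0 : γ ≠ 0) (h1 : γ ≠ 1)
    (v : Fin 2 → F) (h : ∀ w, gramForm₂ γ v w = 0) : v = 0 := by
  have h4 := four_ne_zero_of_two h2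
  refine (LinearMap.BilinForm.nondegenerate_toBilin'_iff_det_ne_zero
    (M := gramMatrix₂ γ)).2 ?_ |>.1 v h
  intro hdet
  rw [Matrix.det_fin_two] at hdet
  simp [gramMatrix₂] at hdet
  field_simp at hdet
  refine mul_ne_zero (mul_ne_zero h4 h0) (sub_ne_zero.2 h1) ?_
  linear_combination -hdet

/-- The images of the basis of the universal algebra in the sum of `F` and the Jordan algebra of
`gramForm₂`. -/
def gramElements₂ (γ : F) (i : Fin 9) : F × JForm (gramForm₂ γ) :=
  (![0, 1, 0, 0, 0, 0, 0, 0, 0] i,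
    JForm.mk _ (![1 / 2, 0, 1 / 2, 0, 0, γ / 2, 0, 0, 0] i)
      (![![1, 0], ![0, 0], ![0, 1], ![0, 0], ![0, 0], ![1 / 2, 1 / 2], ![0, 0], ![0, 0],
        ![0, 0]] i))

theorem sum_smul_gramElements₂ (γ : F) (t : Fin 9 → F) :
    ∑ k, t k • gramElements₂ γ k =
      (t 1, JForm.mk _ (t 0 / 2 + t 2 / 2 + t 5 * γ / 2) ![t 0 + t 5 / 2, t 2 + t 5 / 2]) := by
  refine Prod.ext ?_ (JForm.ext ?_ (funext fun l => ?_))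
  · rw [Prod.fst_sum]
    simp [gramElements₂, Fin.sum_univ_succ]
  · rw [Prod.snd_sum, JForm.sum_fst, JForm.mk_fst]
    simp [gramElements₂, JForm.smul_fst, JForm.mk_fst, Fin.sum_univ_succ]
    ring
  · rw [Prod.snd_sum, JForm.sum_snd, JForm.mk_snd, Finset.sum_apply]
    fin_cases l <;> simp [gramElements₂, JForm.smul_snd, JForm.mk_snd, Fin.sum_univ_succ] <;> ring

set_option maxHeartbeats 4000000 in
-- For α = β = ψ = 0 the axis b goes to the unit of the summand F, while a and c go to rank one
-- idempotents ½ + e_i of the other summand. All products of b with the latter vanish, so only a, b,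
-- c, ac have nonzero images.
theorem gramElements₂_mul (h2 : (2 : F) ≠ 0) {γ : F} (i j : Fin 9) (hij : i ≤ j) :
    gramElements₂ γ i * gramElements₂ γ j =
      ∑ k, universalTable 0 0 γ 0 i j k • gramElements₂ γ k := by
  have h4 := four_ne_zero_of_two h2
  have h8 : (8 : F) ≠ 0 := by
    have := mul_ne_zero h4 h2
    norm_num at this
    exact this
  have h16 : (16 : F) ≠ 0 := by
    have := mul_ne_zero h4 h4
    norm_num at this
    exact this
  have hmul : ∀ i j, gramElements₂ γ i * gramElements₂ γ j = _ := fun i j => by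
    rw [gramElements₂, gramElements₂, Prod.mk_mul_mk, JForm.mk_mul_mk, gramForm₂_apply]
  fin_cases i <;> fin_cases j <;> first
    | exact absurd hij (by decide)
    | (simp only [Fin.zero_eta, Fin.mk_one, Fin.reduceFinMk]
       simp only [universalTable]
       rw [sum_smul_gramElements₂, hmul]
       refine Prod.ext ?_ (JForm.ext ?_ (funext fun l => ?_))
       · simp
       · simp only [JForm.mk_fst, Matrix.cons_val]
         field_simp
         ring
       · rw [JForm.mk_snd, JForm.mk_snd]
         fin_cases l <;> simp <;> field_simp <;> ring)

/-- The multiplication of `F × JForm φ` as a bilinear map. -/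
def prodMulMap {V : Type*} [AddCommGroup V] [Module F V] (φ : LinearMap.BilinForm F V) :
    (F × JForm φ) →ₗ[F] (F × JForm φ) →ₗ[F] (F × JForm φ) :=
  LinearMap.mk₂ F (fun x y => (x.1 * y.1, JForm.mulMap φ x.2 y.2))
    (fun x x' y => by simp [add_mul])
    (fun r x y => by simp [mul_assoc])
    (fun x y y' => by simp [mul_add])
    (fun r x y => by simp [mul_left_comm])

/-- The sum of the product on `F` and the trace form on `JForm φ`. -/
def prodTraceForm {V : Type*} [AddCommGroup V] [Module F V] (φ : LinearMap.BilinForm F V) :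
    LinearMap.BilinForm F (F × JForm φ) :=
  LinearMap.mk₂ F (fun x y => x.1 * y.1 + JForm.traceForm φ x.2 y.2)
    (fun x x' y => by simp [add_mul]; ring)
    (fun r x y => by simp [mul_assoc, mul_add])
    (fun x y y' => by simp [mul_add]; ring)
    (fun r x y => by simp [mul_left_comm, mul_add])

theorem prodTraceForm_apply {V : Type*} [AddCommGroup V] [Module F V]
    (φ : LinearMap.BilinForm F V) (x y : F × JForm φ) :
    prodTraceForm φ x y = x.1 * y.1 + JForm.traceForm φ x.2 y.2 := rfl

theorem semisimpleAlg_algIso_prod_gramForm₂ (h2 : (2 : F) ≠ 0) {γ : F} (h0 : γ ≠ 0)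
    (h1 : γ ≠ 1) : AlgIso F (SemisimpleAlg 0 0 γ 0) (F × JForm (gramForm₂ γ)) := by
  have h4 := four_ne_zero_of_two h2
  have hsymm := gramForm₂_symm γ
  have hγ : γ - 1 ≠ 0 := sub_ne_zero.2 h1
  refine semisimpleAlg_algIso h2 (prodMulMap _) (fun _ _ => rfl)
    (fun x y => Prod.ext (mul_comm _ _) (JForm.mul_comm_of_symm hsymm _ _))
    (gramElements₂ γ) (gramElements₂_mul h2) (prodTraceForm _)
    (fun x y => ?_) (fun x y z => ?_) ?_ ?_ ?_ (fun x hx => ?_) fun t => ?_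
  · rw [prodTraceForm_apply, prodTraceForm_apply, JForm.traceForm_symm hsymm, mul_comm]
  · rw [prodTraceForm_apply, prodTraceForm_apply, Prod.fst_mul, Prod.snd_mul, Prod.fst_mul,
      Prod.snd_mul, JForm.traceForm_assoc hsymm, mul_right_comm]
  · rw [prodTraceForm_apply, JForm.traceForm_apply, gramForm₂_apply]
    simp [gramElements₂, JForm.mk_fst, JForm.mk_snd]
    field_simp
    norm_num
  · rw [prodTraceForm_apply, JForm.traceForm_apply, gramForm₂_apply]
    simp [gramElements₂, JForm.mk_fst, JForm.mk_snd]
  · rw [prodTraceForm_apply, JForm.traceForm_apply, gramForm₂_apply]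
    simp [gramElements₂, JForm.mk_fst, JForm.mk_snd]
    field_simp
    norm_num
  · refine Prod.ext ?_ (JForm.traceForm_nondegenerate h2 (gramForm₂_nondegenerate h2 h0 h1) _
      fun y => ?_)
    · simpa [prodTraceForm_apply] using hx (1, 0)
    · simpa [prodTraceForm_apply] using hx (0, y)
  -- As for S_7, the scalar 2ac - a - c = γ - 1 adjusts the scalar part, and the coefficient of b
  -- gives the component in F.
  · obtain ⟨κ, hκ⟩ : ∃ κ, κ * (γ - 1) = t.2.1 - (t.2.2 0 + t.2.2 1) / 2 :=
      ⟨(t.2.1 - (t.2.2 0 + t.2.2 1) / 2) / (γ - 1), div_mul_cancel₀ _ hγ⟩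
    refine ⟨![t.2.2 0 - κ, t.1, t.2.2 1 - κ, 0, 0, 2 * κ, 0, 0, 0], ?_⟩
    rw [sum_smul_gramElements₂]
    refine Prod.ext ?_ (JForm.ext ?_ (funext fun l => ?_))
    · simp
    · rw [JForm.mk_fst]
      simp
      field_simp at hκ ⊢
      linear_combination hκ
    · rw [JForm.mk_snd]
      fin_cases l <;> simp <;> field_simp <;> ring

end SemisimpleQuotients

end

/-! ### The proposition -/

theorem mainTheorem3 {F : Type*} [Field F] [Invertible (2 : F)] (hF : ∀ x : F, IsSquare x)
    {V : Type*} [AddCommGroup V] [Module F V] (hV : Module.finrank F V = 2)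
    (φ : LinearMap.BilinForm F V) (hφ_symm : φ.IsSymm) (hφ_nondeg : φ.Nondegenerate) :
    -- a 4-dimensional 3-generated algebra of Jordan type `1/2` with trivial radical is isomorphic
    -- to `S_6 ≅ F ⊕ JForm_2(F)` or to `S_7 ≅ M_2^+(F)`
    (∀ {A : Type*} [NonUnitalNonAssocCommRing A] [Module F A]
        [SMulCommClass F A A] [IsScalarTower F A A] (a b c : A),
        IsJordanTypeHalf F ({a, b, c} : Set A) →
        Module.finrank F A = 4 →
        radical F ({a, b, c} : Set A) = ⊥ →
        ((∃ γ : F, γ ≠ 0 ∧ γ ≠ 1 ∧ AlgIso F A (SemisimpleAlg 0 0 γ 0)) ∧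
            AlgIso F A (F × JForm φ)) ∨
          ((∃ α β γ ψ : F, ψ ^ 2 ≠ α * β * γ ∧ α + β + γ = 2 * ψ + 1 ∧ α ≠ 1 ∧
              AlgIso F A (SemisimpleAlg α β γ ψ)) ∧
            AlgIso F A (MPlus 2 F))) ∧
    -- `S_6` is isomorphic to `F ⊕ JForm_2(F)`, for all values of its parameters
    (∀ γ : F, γ ≠ 0 → γ ≠ 1 → AlgIso F (SemisimpleAlg 0 0 γ 0) (F × JForm φ)) ∧
    -- `S_7` is isomorphic to `M_2^+(F)`, for all values of its parameters
    (∀ α β γ ψ : F, ψ ^ 2 ≠ α * β * γ → α + β + γ = 2 * ψ + 1 → α ≠ 1 →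
      AlgIso F (SemisimpleAlg α β γ ψ) (MPlus 2 F)) ∧
    -- the two algebras are not isomorphic, since only the second one is simple
    IsSimpleAlg F (MPlus 2 F) ∧ ¬ IsSimpleAlg F (F × JForm φ) ∧
      ¬ AlgIso F (F × JForm φ) (MPlus 2 F) := by
  have h2 : (2 : F) ≠ 0 := two_ne_zero_of_invertible
  have hs : ∀ x y, φ x y = φ y x := fun x y => hφ_symm.eq x y
  have hn : ∀ x, (∀ y, φ x y = 0) → x = 0 := hφ_nondeg.1
  have h6 : ∀ γ : F, γ ≠ 0 → γ ≠ 1 → AlgIso F (SemisimpleAlg 0 0 γ 0) (F × JForm φ) :=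
    fun γ h0 h1 => (semisimpleAlg_algIso_prod_gramForm₂ h2 h0 h1).trans
      ((AlgIso.refl F).prod (JForm.algIso hF two_pos (by simp) hV (gramForm₂_symm γ)
        (gramForm₂_nondegenerate h2 h0 h1) hs hn))
  have h7 : ∀ α β γ ψ : F, ψ ^ 2 ≠ α * β * γ → α + β + γ = 2 * ψ + 1 → α ≠ 1 →
      AlgIso F (SemisimpleAlg α β γ ψ) (MPlus 2 F) := fun α β γ ψ hψ hsum hα =>
    ((semisimpleAlg_algIso_gramForm h2 hψ hsum hα).trans
      (JForm.algIso hF three_pos (by simp) (by simp)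
        (fun v w => by rw [gramForm_apply, gramForm_apply]; ring)
        (gramForm_nondegenerate h2 hψ hsum)
        (fun v w => by rw [dotForm_apply, dotForm_apply]; ring)
        dotForm_nondegenerate)).trans (algIso_jForm_mPlus hF)
  have hsimple : IsSimpleAlg F (MPlus 2 F) :=
    isSimpleAlg_jForm_dotForm.of_algIso (algIso_jForm_mPlus hF).symm
  refine ⟨?_, h6, h7, hsimple, JForm.not_isSimpleAlg_prod,
    fun h => JForm.not_isSimpleAlg_prod (hsimple.of_algIso h)⟩
  intro A _ _ _ _ a b c hJ hA hrad
  -- Without a Frobenius form the default form is 0, whose radical is the whole 4-dimensional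
  -- algebra.
  have hex : ∃ B : LinearMap.BilinForm F A, IsFrobeniusForm F {a, b, c} B := by
    by_contra hex
    have h0 : frobeniusForm F ({a, b, c} : Set A) = 0 := dif_neg hex
    rw [radical, h0, LinearMap.ker_zero] at hrad
    have := finrank_top F A
    rw [hrad, finrank_bot, hA] at this
    omega
  have hfrob : frobeniusForm F ({a, b, c} : Set A) = hex.choose := dif_pos hex
  have hB := hex.choose_spec
  rw [radical, hfrob] at hrad
  generalize hex.choose = B at hB hrad
  have hax : ∀ x ∈ ({a, b, c} : Set A), IsNormalizedAxis B x := fun x hx =>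
    { hJ.axes x hx with
      symm := hB.symm
      assoc := hB.assoc
      normalized := hB.normalized x hx }
  have hnd : ∀ x, (∀ w, B x w = 0) → x = 0 := fun x hx =>
    LinearMap.ker_eq_bot'.1 hrad x (LinearMap.ext hx)
  rcases algIso_of_finrank_eq_four hF (hax a (by simp)) (hax b (by simp)) (hax c (by simp))
    hJ.generates hnd hA with ⟨δ, hδ, h⟩ | h
  · have hiso : AlgIso F A (F × JForm φ) := h.trans ((AlgIso.refl F).prod
      (JForm.algIso hF two_pos (by simp) hV
        (fun v w => by rw [diagForm_apply, diagForm_apply]; ring) (diagForm_nondegenerate hδ) hs hn))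
    -- Any admissible γ serves; -1 differs from 0 and 1 because the characteristic is not two.
    have hm0 : (-1 : F) ≠ 0 := neg_ne_zero.2 one_ne_zero
    have hm1 : (-1 : F) ≠ 1 := fun h => h2 (by linear_combination -h)
    exact Or.inl ⟨⟨-1, hm0, hm1, hiso.trans (h6 _ hm0 hm1).symm⟩, hiso⟩
  -- Any admissible parameters serve; with α = β = γ = 0 the linear relation forces ψ = -1/2.
  · have hψ : (-1 / 2 : F) ^ 2 ≠ 0 * 0 * 0 := by
      rw [mul_zero]
      exact pow_ne_zero 2 (div_ne_zero (neg_ne_zero.2 one_ne_zero) h2)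
    have hsum : (0 + 0 + 0 : F) = 2 * (-1 / 2) + 1 := by
      field_simp
      ring
    exact Or.inr ⟨⟨0, 0, 0, -1 / 2, hψ, hsum, zero_ne_one,
      h.trans (h7 _ _ _ _ hψ hsum zero_ne_one).symm⟩, h⟩
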